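/- Let $n\ge 2$ and $k\ge 1$ be integers, $\alpha\in\mathbb R$ and $p>1$. For integers $h\ge 1$ put $$H_{\alpha,h}=\frac{n+\alpha}{p}-h,\qquad \gamma_{\alpha,h}=\Big(\frac{n+\alpha}{p}-h\Big)\Big(n-2+h-\frac{n+\alpha}{p}\Big),$$ and let $$c_{\alpha,k,p}=\prod_{h=1}^m|\gamma_{\alpha,2h}|^p\ \text{ if } k=2m,\qquad c_{\alpha,k,p}=|H_{\alpha,1}|^p\prod_{h=1}^m|\gamma_{\alpha,2h+1}|^p\ \text{ if } k=2m+1,$$ where an empty product equals $1$. All functions are real-valued. Let $W^{k,p}(\mathbb R)$ be the space of functions in $L^p(\mathbb R)$ whose weak derivatives up to order $k$ belong to $L^p(\mathbb R)$, with norm $\|g\|_{W^{k,p}}=\big(\int_{\mathbb R}|g^{(k)}|^p\,ds+\int_{\mathbb R}|g|^p\,ds\big)^{1/p}$. Let $C^k_{c,r}(\mathbb R^n\setminus\{0\})$ be the space of radially symmetric $C^k$ functions with compact support in $\mathbb R^n\setminus\{0\}$, and let $\mathcal D^{k,p}_r(\mathbb R^n;|x|^\alpha dx)$ be its completion with respect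 to the norm $$\|u\|_{k,\alpha}=\Big(\int_{\mathbb R^n}|x|^\alpha|\nabla^k u|^p\,dx\Big)^{1/p},\qquad \nabla^k=\Delta^m\ \text{if } k=2m,\quad \nabla^k=\nabla\Delta^m\ \text{if } k=2m+1.$$ Let $\mathcal T_k:C^k_c(\mathbb R)\to C^k_{c,r}(\mathbb R^n\setminus\{0\})$ be the (inverse) $k$-th order Emden–Fowler transform, $(\mathcal T_kg)(x)=|x|^{-H_{\alpha,k}}g(-\log|x|)$ for $x\ne 0$. Assume $c_{\alpha,k,p}>0$. Then there is a linear isomorphism $T:W^{k,p}(\mathbb R)\to\mathcal D^{k,p}_r(\mathbb R^n;|x|^\alpha dx)$, continuous together with its inverse, such that $Tg=\mathcal T_kg$ for all $g\in C^k_c(\mathbb R)$. Moreover $T$ is the only continuous map $W^{k,p}(\mathbb R)\to\mathcal D^{k,p}_r(\mathbb R^n;|x|^\alpha dx)$ that coincides with $\mathcal T_k$ on $C^k_c(\mathbb R)$. -/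

import Mathlib

open MeasureTheory Filter Set
open scoped ENNReal ContDiff Topology Laplacian Gradient

noncomputable section

instance factOneLeOfReal (p : ℝ) [hp : Fact (1 < p)] : Fact (1 ≤ ENNReal.ofReal p) :=
  ⟨by simpa using ENNReal.ofReal_le_ofReal hp.out.le⟩

/-! ### The Sobolev space of order `k` and exponent `p` on the real line -/

/-- `h` is the weak (distributional) derivative of order `j` of `f` on the real line. -/
def HasWeakDeriv (j : ℕ) (f h : ℝ → ℝ) : Prop :=
  ∀ φ : ℝ → ℝ, ContDiff ℝ ∞ φ → HasCompactSupport φ →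
    ∫ s, f s * iteratedDeriv j φ s = (-1) ^ j * ∫ s, h s * φ s

/-- The space `L^p` of the real line. -/
abbrev LpLine (p : ℝ) : Type := Lp ℝ (ENNReal.ofReal p) (volume : Measure ℝ)

theorem LpLine.locallyIntegrable {p : ℝ} [Fact (1 < p)] (f : LpLine p) :
    LocallyIntegrable f volume :=
  (Lp.memLp f).locallyIntegrable (Fact.out : 1 ≤ ENNReal.ofReal p)

theorem LpLine.integrable_mul {p : ℝ} [Fact (1 < p)] (f : LpLine p) {φ : ℝ → ℝ}
    (hφ : Continuous φ) (hc : HasCompactSupport φ) : Integrable (fun s => f s * φ s) := by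
  have := (LpLine.locallyIntegrable f).integrable_smul_left_of_hasCompactSupport hφ hc
  simpa [mul_comm] using this

theorem iteratedDeriv_test {φ : ℝ → ℝ} (hφ : ContDiff ℝ ∞ φ) (hc : HasCompactSupport φ) (j : ℕ) :
    ContDiff ℝ ∞ (iteratedDeriv j φ) ∧ HasCompactSupport (iteratedDeriv j φ) := by
  induction j with
  | zero => simpa [iteratedDeriv_zero] using ⟨hφ, hc⟩
  | succ j ih =>
    rw [iteratedDeriv_succ]
    exact ⟨(contDiff_infty_iff_deriv.1 ih.1).2, ih.2.deriv⟩

theorem HasWeakDeriv.add {p : ℝ} [Fact (1 < p)] {j : ℕ} {f₁ f₂ h₁ h₂ : LpLine p}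
    (H₁ : HasWeakDeriv j f₁ h₁) (H₂ : HasWeakDeriv j f₂ h₂) :
    HasWeakDeriv j ((f₁ + f₂ : LpLine p) : ℝ → ℝ) ((h₁ + h₂ : LpLine p) : ℝ → ℝ) := by
  intro φ hφ hc
  obtain ⟨hd, hdc⟩ := iteratedDeriv_test hφ hc j
  have e₁ : ∫ s, (f₁ + f₂ : LpLine p) s * iteratedDeriv j φ s
      = (∫ s, f₁ s * iteratedDeriv j φ s) + ∫ s, f₂ s * iteratedDeriv j φ s := by
    rw [← integral_add (LpLine.integrable_mul f₁ hd.continuous hdc)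
      (LpLine.integrable_mul f₂ hd.continuous hdc)]
    refine integral_congr_ae ?_
    filter_upwards [Lp.coeFn_add f₁ f₂] with s hs
    rw [hs, Pi.add_apply, add_mul]
  have e₂ : ∫ s, (h₁ + h₂ : LpLine p) s * φ s = (∫ s, h₁ s * φ s) + ∫ s, h₂ s * φ s := by
    rw [← integral_add (LpLine.integrable_mul h₁ hφ.continuous hc)
      (LpLine.integrable_mul h₂ hφ.continuous hc)]
    refine integral_congr_ae ?_
    filter_upwards [Lp.coeFn_add h₁ h₂] with s hs
    rw [hs, Pi.add_apply, add_mul]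
  rw [e₁, e₂, H₁ φ hφ hc, H₂ φ hφ hc, mul_add]

theorem HasWeakDeriv.smul {p : ℝ} [Fact (1 < p)] {j : ℕ} {f h : LpLine p} (c : ℝ)
    (H : HasWeakDeriv j f h) :
    HasWeakDeriv j ((c • f : LpLine p) : ℝ → ℝ) ((c • h : LpLine p) : ℝ → ℝ) := by
  intro φ hφ hc
  have e : ∀ (u : LpLine p) (ψ : ℝ → ℝ),
      ∫ s, (c • u : LpLine p) s * ψ s = c * ∫ s, u s * ψ s := by
    intro u ψ
    rw [← integral_const_mul]
    refine integral_congr_ae ?_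
    filter_upwards [Lp.coeFn_smul c u] with s hs
    rw [hs, Pi.smul_apply, smul_eq_mul, mul_assoc]
  rw [e, e, H φ hφ hc]
  ring

theorem HasWeakDeriv.unique {p : ℝ} [Fact (1 < p)] {j : ℕ} {f : ℝ → ℝ} {h₁ h₂ : LpLine p}
    (H₁ : HasWeakDeriv j f h₁) (H₂ : HasWeakDeriv j f h₂) : h₁ = h₂ := by
  have key := ae_eq_zero_of_integral_contDiff_smul_eq_zero (μ := (volume : Measure ℝ))
    (f := fun s => h₁ s - h₂ s)
    ((LpLine.locallyIntegrable h₁).sub (LpLine.locallyIntegrable h₂)) (by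
      intro φ hφ hc
      have e : ∫ s, h₁ s * φ s = ∫ s, h₂ s * φ s :=
        mul_left_cancel₀ (pow_ne_zero j (by norm_num : (-1 : ℝ) ≠ 0))
          ((H₁ φ hφ hc).symm.trans (H₂ φ hφ hc))
      have := integral_sub (LpLine.integrable_mul h₁ hφ.continuous hc)
        (LpLine.integrable_mul h₂ hφ.continuous hc)
      rw [e, sub_self] at this
      rw [← this]
      congr 1
      ext s
      simp only [smul_eq_mul]
      ring)
  refine Lp.ext ?_
  filter_upwards [key] with s hs
  exact sub_eq_zero.1 hs

/-- The functions in `L^p(ℝ)` all of whose weak derivatives up to the order `k` are in `L^p(ℝ)`. -/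
def sobolevSubmodule (k : ℕ) (p : ℝ) [Fact (1 < p)] : Submodule ℝ (LpLine p) where
  carrier := {f | ∀ j ≤ k, ∃ h : LpLine p, HasWeakDeriv j f h}
  add_mem' := fun ha hb j hj =>
    let ⟨u, hu⟩ := ha j hj
    let ⟨v, hv⟩ := hb j hj
    ⟨u + v, hu.add hv⟩
  zero_mem' := fun j _ => ⟨0, by
    have h := Lp.coeFn_zero ℝ (ENNReal.ofReal p) (volume : Measure ℝ)
    intro φ _ _
    have e : ∀ ψ : ℝ → ℝ, ∫ s, (0 : LpLine p) s * ψ s = 0 := by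
      intro ψ
      refine (integral_congr_ae (g := fun _ => (0 : ℝ)) ?_).trans (by simp)
      filter_upwards [h] with s hs
      rw [hs]
      simp
    rw [e, e, mul_zero]⟩
  smul_mem' := fun c _ ha j hj =>
    let ⟨u, hu⟩ := ha j hj
    ⟨c • u, hu.smul c⟩

/-- The Sobolev space `W^{k,p}(ℝ)`. It gets its own norm below, not the one of `L^p`. -/
def SobolevSpace (k : ℕ) (p : ℝ) [Fact (1 < p)] : Type := sobolevSubmodule k p

namespace SobolevSpace

variable {k : ℕ} {p : ℝ} [Fact (1 < p)]

instance : AddCommGroup (SobolevSpace k p) :=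
  inferInstanceAs (AddCommGroup (sobolevSubmodule k p))

instance : Module ℝ (SobolevSpace k p) :=
  inferInstanceAs (Module ℝ (sobolevSubmodule k p))

/-- The element of `L^p` underlying an element of `W^{k,p}(ℝ)`. -/
def toLp : SobolevSpace k p →ₗ[ℝ] LpLine p := (sobolevSubmodule k p).subtype

theorem exists_weakDeriv (g : SobolevSpace k p) :
    ∃ h : LpLine p, HasWeakDeriv k (toLp g) h := g.2 k le_rfl

/-- The weak derivative of order `k` of a function in `W^{k,p}(ℝ)`. -/
def weakDeriv : SobolevSpace k p →ₗ[ℝ] LpLine p where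
  toFun g := (exists_weakDeriv g).choose
  map_add' a b := HasWeakDeriv.unique (exists_weakDeriv (a + b)).choose_spec
    ((exists_weakDeriv a).choose_spec.add (exists_weakDeriv b).choose_spec)
  map_smul' c a := HasWeakDeriv.unique (exists_weakDeriv (c • a)).choose_spec
    ((exists_weakDeriv a).choose_spec.smul c)

theorem hasWeakDeriv (g : SobolevSpace k p) : HasWeakDeriv k (toLp g) (weakDeriv g) :=
  (exists_weakDeriv g).choose_spec

/-- The map `g ↦ (g^{(k)}, g)` into the `ℓ^p`-product of two copies of `L^p`. -/
def toPair : SobolevSpace k p →ₗ[ℝ] WithLp (ENNReal.ofReal p) (LpLine p × LpLine p) :=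
  (WithLp.linearEquiv (ENNReal.ofReal p) ℝ (LpLine p × LpLine p)).symm.toLinearMap ∘ₗ
    (weakDeriv.prod toLp)

theorem toPair_injective : Function.Injective (toPair (k := k) (p := p)) := by
  intro a b h
  have h' := congrArg (fun z => (WithLp.ofLp z).2) h
  exact Subtype.ext h'

instance : NormedAddCommGroup (SobolevSpace k p) :=
  NormedAddCommGroup.induced _ _ toPair toPair_injective

instance : NormedSpace ℝ (SobolevSpace k p) :=
  NormedSpace.induced ℝ (SobolevSpace k p)
    (WithLp (ENNReal.ofReal p) (LpLine p × LpLine p)) toPair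

/-- The norm is `(∫ |g^{(k)}|^p + ∫ |g|^p)^{1/p}`. -/
theorem norm_eq (g : SobolevSpace k p) :
    ‖g‖ = ((∫ s, |weakDeriv g s| ^ p) + ∫ s, |toLp g s| ^ p) ^ (1 / p) := by
  have hp : 1 < p := Fact.out
  have hp0 : 0 < p := by linarith
  have hr : (ENNReal.ofReal p).toReal = p := ENNReal.toReal_ofReal hp0.le
  have key : ∀ u : LpLine p, ‖u‖ ^ p = ∫ s, |u s| ^ p := by
    intro u
    rw [Lp.norm_def, (Lp.memLp u).eLpNorm_eq_integral_rpow_norm (by simpa using hp0)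
      ENNReal.ofReal_ne_top, hr, ENNReal.toReal_ofReal (by positivity),
      Real.rpow_inv_rpow (by positivity) hp0.ne']
    simp
  have h1 : ‖g‖ = ‖toPair g‖ := rfl
  rw [h1, WithLp.prod_norm_eq_add (by rw [hr]; exact hp0), hr, ← key, ← key]
  rfl

end SobolevSpace

/-! ### Test functions on the line and their inclusion into the Sobolev space -/

/-- `C_c^k(ℝ)`. -/
def lineTest (k : ℕ) : Submodule ℝ (ℝ → ℝ) where
  carrier := {g | ContDiff ℝ k g ∧ HasCompactSupport g}
  add_mem' := fun ha hb => ⟨ha.1.add hb.1, ha.2.add hb.2⟩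
  zero_mem' := ⟨contDiff_const, HasCompactSupport.zero⟩
  smul_mem' := fun c _ ha => ⟨contDiff_const.smul ha.1, ha.2.smul_left (f := fun _ => c)⟩

theorem lineTest_iteratedDeriv {k j : ℕ} (hj : j ≤ k) (g : lineTest k) :
    Continuous (iteratedDeriv j g.1) ∧ HasCompactSupport (iteratedDeriv j g.1) := by
  refine ⟨g.2.1.continuous_iteratedDeriv j (by exact_mod_cast hj), ?_⟩
  clear hj
  induction j with
  | zero => simpa [iteratedDeriv_zero] using g.2.2
  | succ j ih => rw [iteratedDeriv_succ]; exact ih.deriv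

theorem lineTest_memLp {k j : ℕ} (hj : j ≤ k) (g : lineTest k) (p : ℝ) :
    MemLp (iteratedDeriv j g.1) (ENNReal.ofReal p) (volume : Measure ℝ) :=
  (lineTest_iteratedDeriv hj g).1.memLp_of_hasCompactSupport (lineTest_iteratedDeriv hj g).2

theorem lineTest_hasWeakDeriv {k j : ℕ} (hj : j ≤ k) (g : lineTest k) :
    HasWeakDeriv j g.1 (iteratedDeriv j g.1) := by
  induction j with
  | zero => intro φ _ _; simp [iteratedDeriv_zero]
  | succ j ih =>
    intro φ hφ hc
    have hφ' : ContDiff ℝ ∞ (deriv φ) := (contDiff_infty_iff_deriv.1 hφ).2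
    have h1 := ih (by omega) (deriv φ) hφ' hc.deriv
    rw [← iteratedDeriv_succ'] at h1
    rw [h1]
    obtain ⟨cj, kj⟩ := lineTest_iteratedDeriv (by omega : j ≤ k) g
    obtain ⟨cj', kj'⟩ := lineTest_iteratedDeriv hj g
    have hdiff : Differentiable ℝ (iteratedDeriv j g.1) :=
      g.2.1.differentiable_iteratedDeriv j (by exact_mod_cast hj)
    have h2 := integral_mul_deriv_eq_deriv_mul_of_integrable
      (u := iteratedDeriv j g.1) (u' := iteratedDeriv (j + 1) g.1) (v := φ) (v' := deriv φ)
      (fun x _ => by rw [iteratedDeriv_succ]; exact (hdiff x).hasDerivAt)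
      (fun x _ => (hφ.differentiable (by simp) x).hasDerivAt)
      ((cj.mul hφ'.continuous).integrable_of_hasCompactSupport kj.mul_right)
      ((cj'.mul hφ.continuous).integrable_of_hasCompactSupport kj'.mul_right)
      ((cj.mul hφ.continuous).integrable_of_hasCompactSupport kj.mul_right)
    rw [h2]
    ring

theorem HasWeakDeriv.congr {j : ℕ} {f f' h h' : ℝ → ℝ} (hf : f' =ᵐ[volume] f)
    (hh : h' =ᵐ[volume] h) (H : HasWeakDeriv j f h) : HasWeakDeriv j f' h' := by
  intro φ hφ hc
  have e₁ : ∫ s, f' s * iteratedDeriv j φ s = ∫ s, f s * iteratedDeriv j φ s :=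
    integral_congr_ae (by filter_upwards [hf] with s hs; rw [hs])
  have e₂ : ∫ s, h' s * φ s = ∫ s, h s * φ s :=
    integral_congr_ae (by filter_upwards [hh] with s hs; rw [hs])
  rw [e₁, e₂, H φ hφ hc]

/-- The inclusion of `C_c^k(ℝ)` into `W^{k,p}(ℝ)`: the class of `g` in `L^p`. -/
def lineTestToSobolev (k : ℕ) (p : ℝ) [Fact (1 < p)] (g : lineTest k) : SobolevSpace k p :=
  ⟨(lineTest_memLp (Nat.zero_le k) g p).toLp g.1, fun _ hj =>
    ⟨(lineTest_memLp hj g p).toLp _,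
      (lineTest_hasWeakDeriv hj g).congr (MemLp.coeFn_toLp _) (MemLp.coeFn_toLp _)⟩⟩

/-! ### Radial test functions on the punctured space, and the weighted norm -/

/-- `C_{c,r}^k(ℝⁿ \ {0})`: radially symmetric functions of class `C^k` with compact support in
`ℝⁿ \ {0}` (extended by `0` at the origin). -/
def radialTest (n k : ℕ) : Submodule ℝ (EuclideanSpace ℝ (Fin n) → ℝ) where
  carrier := {u | ContDiff ℝ k u ∧ HasCompactSupport u ∧ 0 ∉ tsupport u ∧
    ∀ x y, ‖x‖ = ‖y‖ → u x = u y}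
  add_mem' := fun {a b} ha hb => ⟨ha.1.add hb.1, ha.2.1.add hb.2.1,
    fun h => (tsupport_add a b h).elim ha.2.2.1 hb.2.2.1, fun x y h => by
      simp only [Pi.add_apply, ha.2.2.2 x y h, hb.2.2.2 x y h]⟩
  zero_mem' := ⟨contDiff_const, HasCompactSupport.zero, by simp [tsupport], fun _ _ _ => rfl⟩
  smul_mem' := fun c u ha => ⟨contDiff_const.smul ha.1, ha.2.1.smul_left (f := fun _ => c),
    fun h => ha.2.2.1 (tsupport_smul_subset_right (fun _ => c) u h), fun x y h => by
      simp only [Pi.smul_apply, ha.2.2.2 x y h]⟩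

/-- `(∫ |x|^α |v|^p dx)^{1/p}` for a scalar or vector field `v` on `ℝⁿ`. -/
def weightedNorm {n : ℕ} {F : Type*} [NormedAddCommGroup F] (α p : ℝ)
    (v : EuclideanSpace ℝ (Fin n) → F) : ℝ :=
  (∫ x, ‖x‖ ^ α * ‖v x‖ ^ p) ^ (1 / p)

/-- `‖u‖_{k,α} = (∫ |x|^α |∇^k u|^p dx)^{1/p}`, where `∇^k u` is `Δ^m u` for `k = 2m` and
`∇ (Δ^m u)` for `k = 2m + 1`. -/
def radialNorm {n : ℕ} (k : ℕ) (α p : ℝ) (u : EuclideanSpace ℝ (Fin n) → ℝ) : ℝ :=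
  if Even k then weightedNorm α p ((fun w : EuclideanSpace ℝ (Fin n) → ℝ => Δ w)^[k / 2] u)
  else weightedNorm α p (∇ ((fun w : EuclideanSpace ℝ (Fin n) → ℝ => Δ w)^[k / 2] u))

section WeightedNorm

variable {n : ℕ} {F : Type*} [NormedAddCommGroup F] [NormedSpace ℝ F]

theorem weight_continuous {v : EuclideanSpace ℝ (Fin n) → F} (hv : Continuous v)
    (h0 : 0 ∉ tsupport v) (a : ℝ) : Continuous fun x => ‖x‖ ^ a • v x := by
  rw [continuous_iff_continuousAt]
  intro x
  by_cases hx : x = 0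
  · subst hx
    have h : v =ᶠ[𝓝 0] 0 := notMem_tsupport_iff_eventuallyEq.1 h0
    refine (continuousAt_const (y := (0 : F))).congr ?_
    filter_upwards [h] with y hy
    simp [hy]
  · exact (continuous_norm.continuousAt.rpow_const (Or.inl (norm_ne_zero_iff.2 hx))).smul
      hv.continuousAt

theorem weight_memLp {v : EuclideanSpace ℝ (Fin n) → F} (hv : Continuous v)
    (hc : HasCompactSupport v) (h0 : 0 ∉ tsupport v) (a p : ℝ) :
    MemLp (fun x => ‖x‖ ^ a • v x) (ENNReal.ofReal p) volume :=
  (weight_continuous hv h0 a).memLp_of_hasCompactSupport (hc.smul_left (f := fun x => ‖x‖ ^ a))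

theorem weightedNorm_eq {v : EuclideanSpace ℝ (Fin n) → F} (hv : Continuous v)
    (hc : HasCompactSupport v) (h0 : 0 ∉ tsupport v) (α : ℝ) {p : ℝ} (hp : 1 < p) :
    weightedNorm α p v
      = (eLpNorm (fun x => ‖x‖ ^ (α / p) • v x) (ENNReal.ofReal p) volume).toReal := by
  have hp0 : 0 < p := by linarith
  have hr : (ENNReal.ofReal p).toReal = p := ENNReal.toReal_ofReal hp0.le
  rw [(weight_memLp hv hc h0 (α / p) p).eLpNorm_eq_integral_rpow_norm (by simpa using hp0)
      ENNReal.ofReal_ne_top, hr, ENNReal.toReal_ofReal (by positivity), weightedNorm, one_div]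
  congr 2
  ext x
  rw [norm_smul, Real.norm_of_nonneg (by positivity), Real.mul_rpow (by positivity) (by positivity),
    ← Real.rpow_mul (by positivity), div_mul_cancel₀ _ hp0.ne']

theorem weightedNorm_add_le {v w : EuclideanSpace ℝ (Fin n) → F} (hv : Continuous v)
    (hvc : HasCompactSupport v) (hv0 : 0 ∉ tsupport v) (hw : Continuous w)
    (hwc : HasCompactSupport w) (hw0 : 0 ∉ tsupport w) (α : ℝ) {p : ℝ} (hp : 1 < p) :
    weightedNorm α p (v + w) ≤ weightedNorm α p v + weightedNorm α p w := by
  have hvw0 : 0 ∉ tsupport (v + w) := fun h => (tsupport_add v w h).elim hv0 hw0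
  rw [weightedNorm_eq hv hvc hv0 α hp, weightedNorm_eq hw hwc hw0 α hp,
    weightedNorm_eq (hv.add hw) (hvc.add hwc) hvw0 α hp]
  have mv := weight_memLp hv hvc hv0 (α / p) p
  have mw := weight_memLp hw hwc hw0 (α / p) p
  rw [← ENNReal.toReal_add mv.eLpNorm_ne_top mw.eLpNorm_ne_top]
  refine ENNReal.toReal_mono (ENNReal.add_ne_top.2 ⟨mv.eLpNorm_ne_top, mw.eLpNorm_ne_top⟩) ?_
  have := eLpNorm_add_le mv.1 mw.1
    (show 1 ≤ ENNReal.ofReal p by simpa using hp.le)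
  refine le_trans (le_of_eq ?_) this
  congr 1
  ext x
  simp [smul_add]

theorem weightedNorm_smul (c : ℝ) (v : EuclideanSpace ℝ (Fin n) → F) (α : ℝ) {p : ℝ}
    (hp : 1 < p) : weightedNorm α p (c • v) = |c| * weightedNorm α p v := by
  have hp0 : 0 < p := by linarith
  have h : ∀ x, ‖x‖ ^ α * ‖(c • v) x‖ ^ p = |c| ^ p * (‖x‖ ^ α * ‖v x‖ ^ p) := by
    intro x
    rw [Pi.smul_apply, norm_smul, Real.norm_eq_abs, Real.mul_rpow (by positivity) (by positivity)]
    ring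
  have hI : 0 ≤ ∫ x, ‖x‖ ^ α * ‖v x‖ ^ p := integral_nonneg fun x => by positivity
  simp only [weightedNorm, h]
  rw [integral_const_mul, Real.mul_rpow (by positivity) hI, one_div,
    Real.rpow_rpow_inv (by positivity) hp0.ne']

end WeightedNorm

section Laplace

variable {n : ℕ}

theorem contDiff_laplacian {j : ℕ} {u : EuclideanSpace ℝ (Fin n) → ℝ}
    (hu : ContDiff ℝ (j + 2 : ℕ) u) : ContDiff ℝ j (Δ u) := by
  rw [InnerProductSpace.laplacian_eq_iteratedFDeriv_stdOrthonormalBasis]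
  refine ContDiff.sum fun i _ => ?_
  have h : ContDiff ℝ j (iteratedFDeriv ℝ 2 u) :=
    hu.iteratedFDeriv_right (by exact_mod_cast le_rfl)
  exact (ContinuousMultilinearMap.apply ℝ (fun _ : Fin 2 => EuclideanSpace ℝ (Fin n)) ℝ
    _).contDiff.comp h

theorem contDiff_iterate_laplacian (m : ℕ) {j : ℕ} {u : EuclideanSpace ℝ (Fin n) → ℝ}
    (hu : ContDiff ℝ (j + 2 * m : ℕ) u) :
    ContDiff ℝ j ((fun w : EuclideanSpace ℝ (Fin n) → ℝ => Δ w)^[m] u) := by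
  induction m generalizing u with
  | zero => simpa using hu
  | succ m ih =>
    rw [Function.iterate_succ_apply]
    exact ih (contDiff_laplacian (j := j + 2 * m) hu)

theorem tsupport_laplacian (u : EuclideanSpace ℝ (Fin n) → ℝ) : tsupport (Δ u) ⊆ tsupport u := by
  intro x hx
  by_contra h
  have h1 : u =ᶠ[𝓝 x] fun _ => (0 : ℝ) := notMem_tsupport_iff_eventuallyEq.1 h
  have h2 := InnerProductSpace.laplacian_congr_nhds h1
  rw [InnerProductSpace.laplacian_const] at h2
  exact notMem_tsupport_iff_eventuallyEq.2 h2 hx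

theorem tsupport_iterate_laplacian (m : ℕ) (u : EuclideanSpace ℝ (Fin n) → ℝ) :
    tsupport ((fun w : EuclideanSpace ℝ (Fin n) → ℝ => Δ w)^[m] u) ⊆ tsupport u := by
  induction m with
  | zero => simp
  | succ m ih =>
    rw [Function.iterate_succ_apply']
    exact (tsupport_laplacian _).trans ih

theorem iterate_laplacian_add (m : ℕ) {u v : EuclideanSpace ℝ (Fin n) → ℝ}
    (hu : ContDiff ℝ (2 * m : ℕ) u) (hv : ContDiff ℝ (2 * m : ℕ) v) :
    (fun w : EuclideanSpace ℝ (Fin n) → ℝ => Δ w)^[m] (u + v)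
      = (fun w : EuclideanSpace ℝ (Fin n) → ℝ => Δ w)^[m] u
        + (fun w : EuclideanSpace ℝ (Fin n) → ℝ => Δ w)^[m] v := by
  induction m generalizing u v with
  | zero => rfl
  | succ m ih =>
    simp only [Function.iterate_succ_apply]
    have h2 : ((2 : ℕ) : WithTop ℕ∞) ≤ ((2 * (m + 1) : ℕ) : WithTop ℕ∞) := by
      exact_mod_cast (by omega : 2 ≤ 2 * (m + 1))
    have e : Δ (u + v) = Δ u + Δ v := by
      ext x
      exact (hu.of_le h2).contDiffAt.laplacian_add (hv.of_le h2).contDiffAt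
    rw [e]
    exact ih (contDiff_laplacian hu) (contDiff_laplacian hv)

theorem iterate_laplacian_smul (m : ℕ) (c : ℝ) {u : EuclideanSpace ℝ (Fin n) → ℝ}
    (hu : ContDiff ℝ (2 * m : ℕ) u) :
    (fun w : EuclideanSpace ℝ (Fin n) → ℝ => Δ w)^[m] (c • u)
      = c • (fun w : EuclideanSpace ℝ (Fin n) → ℝ => Δ w)^[m] u := by
  induction m generalizing u with
  | zero => rfl
  | succ m ih =>
    simp only [Function.iterate_succ_apply]
    have h2 : ((2 : ℕ) : WithTop ℕ∞) ≤ ((2 * (m + 1) : ℕ) : WithTop ℕ∞) := by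
      exact_mod_cast (by omega : 2 ≤ 2 * (m + 1))
    have e : Δ (c • u) = c • Δ u := by
      ext x
      exact InnerProductSpace.laplacian_smul c (hu.of_le h2).contDiffAt
    rw [e]
    exact ih (contDiff_laplacian hu)

theorem gradient_add_fun {u v : EuclideanSpace ℝ (Fin n) → ℝ} (hu : ContDiff ℝ 1 u)
    (hv : ContDiff ℝ 1 v) : ∇ (u + v) = ∇ u + ∇ v := by
  ext1 x
  simp only [gradient, Pi.add_apply, ← map_add]
  rw [fderiv_add (hu.differentiable (by simp) x) (hv.differentiable (by simp) x)]

theorem gradient_smul_fun (c : ℝ) {u : EuclideanSpace ℝ (Fin n) → ℝ} (hu : ContDiff ℝ 1 u) :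
    ∇ (c • u) = c • ∇ u := by
  ext1 x
  simp only [gradient, Pi.smul_apply]
  rw [fderiv_const_smul (hu.differentiable (by simp) x)]
  simp

theorem continuous_gradient_fun {u : EuclideanSpace ℝ (Fin n) → ℝ} (hu : ContDiff ℝ 1 u) :
    Continuous (∇ u) :=
  (InnerProductSpace.toDual ℝ (EuclideanSpace ℝ (Fin n))).symm.continuous.comp
    (hu.continuous_fderiv (by simp))

theorem tsupport_gradient_fun (u : EuclideanSpace ℝ (Fin n) → ℝ) :
    tsupport (∇ u) ⊆ tsupport u := by
  refine (closure_mono ?_).trans (tsupport_fderiv_subset ℝ)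
  intro x hx h
  exact hx (by simp [gradient, h])

end Laplace

/-- `C_{c,r}^k(ℝⁿ \ {0})` regarded as a space with the norm `‖·‖_{k,α}` of exponent `p`. -/
def RadialSpace (n k : ℕ) (_α _p : ℝ) : Type := radialTest n k

namespace RadialSpace

variable {n k : ℕ} {α p : ℝ}

instance : AddCommGroup (RadialSpace n k α p) := inferInstanceAs (AddCommGroup (radialTest n k))

instance : Module ℝ (RadialSpace n k α p) := inferInstanceAs (Module ℝ (radialTest n k))

/-- The function on `ℝⁿ` underlying an element of `C_{c,r}^k(ℝⁿ \ {0})`. -/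
def toFun : RadialSpace n k α p →ₗ[ℝ] (EuclideanSpace ℝ (Fin n) → ℝ) := (radialTest n k).subtype

theorem contDiff_half (u : radialTest n k) : ContDiff ℝ (2 * (k / 2) : ℕ) u.1 :=
  u.2.1.of_le (by exact_mod_cast (by omega : 2 * (k / 2) ≤ k))

theorem contDiff_iterate_odd (hk : ¬ Even k) (u : radialTest n k) :
    ContDiff ℝ 1 ((fun w : EuclideanSpace ℝ (Fin n) → ℝ => Δ w)^[k / 2] u.1) := by
  have h := contDiff_iterate_laplacian (k / 2) (j := 1) (u := u.1)
    (u.2.1.of_le (by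
      have : 1 + 2 * (k / 2) ≤ k := by
        have := Nat.not_even_iff.1 hk
        omega
      exact_mod_cast this))
  exact_mod_cast h

theorem contDiff_iterate_even (u : radialTest n k) :
    Continuous ((fun w : EuclideanSpace ℝ (Fin n) → ℝ => Δ w)^[k / 2] u.1) :=
  (contDiff_iterate_laplacian (k / 2) (j := 0) (u := u.1)
    (by simpa using contDiff_half u)).continuous

theorem radialNorm_smul (c : ℝ) (u : radialTest n k) (hp : 1 < p) :
    radialNorm k α p (c • u.1) = |c| * radialNorm k α p u.1 := by
  unfold radialNorm
  rw [iterate_laplacian_smul _ c (contDiff_half u)]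
  split_ifs with hk
  · exact weightedNorm_smul c _ α hp
  · rw [gradient_smul_fun c (contDiff_iterate_odd hk u)]
    exact weightedNorm_smul c _ α hp

theorem radialNorm_add_le (u v : radialTest n k) (hp : 1 < p) :
    radialNorm k α p (u.1 + v.1) ≤ radialNorm k α p u.1 + radialNorm k α p v.1 := by
  unfold radialNorm
  rw [iterate_laplacian_add _ (contDiff_half u) (contDiff_half v)]
  have su := fun w : radialTest n k => tsupport_iterate_laplacian (k / 2) w.1
  split_ifs with hk
  · exact weightedNorm_add_le (contDiff_iterate_even u)
      (u.2.2.1.mono' (subset_closure.trans (su u))) (fun h => u.2.2.2.1 (su u h))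
      (contDiff_iterate_even v)
      (v.2.2.1.mono' (subset_closure.trans (su v))) (fun h => v.2.2.2.1 (su v h)) α hp
  · rw [gradient_add_fun (contDiff_iterate_odd hk u) (contDiff_iterate_odd hk v)]
    have sg := fun w : radialTest n k => (tsupport_gradient_fun _).trans (su w)
    exact weightedNorm_add_le (continuous_gradient_fun (contDiff_iterate_odd hk u))
      (u.2.2.1.mono' (subset_closure.trans (sg u)))
      (fun h => u.2.2.2.1 (sg u h)) (continuous_gradient_fun (contDiff_iterate_odd hk v))
      (v.2.2.1.mono' (subset_closure.trans (sg v))) (fun h => v.2.2.2.1 (sg v h)) α hp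

variable [hp : Fact (1 < p)]

instance : SeminormedAddCommGroup (RadialSpace n k α p) :=
  AddGroupSeminorm.toSeminormedAddCommGroup
    { toFun := fun u => radialNorm k α p (toFun u)
      map_zero' := by
        have h := radialNorm_smul (α := α) 0 (0 : radialTest n k) hp.out
        simp only [zero_smul, abs_zero, zero_mul] at h
        exact h
      add_le' := fun u v => radialNorm_add_le u v hp.out
      neg' := fun u => by
        have h := radialNorm_smul (α := α) (-1) (show radialTest n k from u) hp.out
        simp only [neg_smul, one_smul, abs_neg, abs_one, one_mul] at h
        exact h }

theorem norm_eq (u : RadialSpace n k α p) : ‖u‖ = radialNorm k α p (toFun u) := rfl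

instance : NormedSpace ℝ (RadialSpace n k α p) where
  norm_smul_le c u := (radialNorm_smul c (show radialTest n k from u) hp.out).le

end RadialSpace

/-- The space `D_r^{k,p}(ℝⁿ; |x|^α dx)`: the completion of `C_{c,r}^k(ℝⁿ \ {0})` with respect to
the norm `‖·‖_{k,α}`. -/
abbrev DRadial (n k : ℕ) (α p : ℝ) [Fact (1 < p)] : Type :=
  UniformSpace.Completion (RadialSpace n k α p)

/-! ### The constants and the Emden-Fowler transform -/

/-- `H_{α,h} = (n + α) / p - h`. -/
def hardyExp (n : ℕ) (α p : ℝ) (h : ℕ) : ℝ := (n + α) / p - h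

/-- `γ_{α,h} = ((n + α) / p - h) (n - 2 + h - (n + α) / p)`. -/
def gammaConst (n : ℕ) (α p : ℝ) (h : ℕ) : ℝ :=
  ((n + α) / p - h) * (n - 2 + h - (n + α) / p)

/-- The constant `c_{α,k,p}`: the product of `|γ_{α,2h}|^p` over `1 ≤ h ≤ m` if `k = 2m`, and
`|H_{α,1}|^p` times the product of `|γ_{α,2h+1}|^p` over `1 ≤ h ≤ m` if `k = 2m + 1`. -/
def rellichConst (n k : ℕ) (α p : ℝ) : ℝ :=
  if Even k then ∏ h ∈ Finset.Icc 1 (k / 2), |gammaConst n α p (2 * h)| ^ p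
  else |hardyExp n α p 1| ^ p * ∏ h ∈ Finset.Icc 1 (k / 2), |gammaConst n α p (2 * h + 1)| ^ p

/-- The function `x ↦ |x|^{-H_{α,k}} g(-log |x|)` on `ℝⁿ \ {0}`, extended by `0`. -/
def emdenFowlerFun (n k : ℕ) (α p : ℝ) (g : ℝ → ℝ) (x : EuclideanSpace ℝ (Fin n)) : ℝ :=
  if x = 0 then 0 else ‖x‖ ^ (-hardyExp n α p k) * g (-Real.log ‖x‖)

theorem emdenFowlerFun_support (n k : ℕ) (α p : ℝ) {g : ℝ → ℝ} (hg : HasCompactSupport g) :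
    ∃ a b : ℝ, 0 < a ∧ ∀ x : EuclideanSpace ℝ (Fin n),
      emdenFowlerFun n k α p g x ≠ 0 → a ≤ ‖x‖ ∧ ‖x‖ ≤ b := by
  obtain ⟨R, hR⟩ := hg.isBounded.subset_closedBall 0
  refine ⟨Real.exp (-R), Real.exp R, Real.exp_pos _, fun x hx => ?_⟩
  have hx0 : x ≠ 0 := fun h => hx (by simp [emdenFowlerFun, h])
  have hpos : 0 < ‖x‖ := norm_pos_iff.2 hx0
  have hgx : g (-Real.log ‖x‖) ≠ 0 := fun h => hx (by simp [emdenFowlerFun, h])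
  have := hR (subset_tsupport g hgx)
  rw [mem_closedBall_zero_iff, Real.norm_eq_abs, abs_neg, abs_le] at this
  exact ⟨(Real.le_log_iff_exp_le hpos).1 this.1, (Real.log_le_iff_le_exp hpos).1 this.2⟩

theorem emdenFowlerFun_mem (n k : ℕ) (α p : ℝ) (g : lineTest k) :
    emdenFowlerFun n k α p g.1 ∈ radialTest n k := by
  obtain ⟨a, b, ha, hab⟩ := emdenFowlerFun_support n k α p g.2.2
  have hcl : IsClosed {x : EuclideanSpace ℝ (Fin n) | a ≤ ‖x‖} :=
    isClosed_le continuous_const continuous_norm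
  have h0 : (0 : EuclideanSpace ℝ (Fin n)) ∉ tsupport (emdenFowlerFun n k α p g.1) := by
    intro h
    have := closure_minimal (fun x hx => (hab x hx).1) hcl h
    have h' : a ≤ ‖(0 : EuclideanSpace ℝ (Fin n))‖ := this
    rw [norm_zero] at h'
    linarith
  refine ⟨?_, ?_, h0, ?_⟩
  · rw [contDiff_iff_contDiffAt]
    intro x
    by_cases hx : x = 0
    · subst hx
      exact contDiffAt_const.congr_of_eventuallyEq (notMem_tsupport_iff_eventuallyEq.1 h0)
    · have hn : ContDiffAt ℝ k (fun y : EuclideanSpace ℝ (Fin n) => ‖y‖) x := contDiffAt_norm ℝ hx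
      have hne : ‖x‖ ≠ 0 := norm_ne_zero_iff.2 hx
      have h1 : ContDiffAt ℝ k (fun y : EuclideanSpace ℝ (Fin n) =>
          ‖y‖ ^ (-hardyExp n α p k) * g.1 (-Real.log ‖y‖)) x :=
        (hn.rpow_const_of_ne hne).mul (g.2.1.contDiffAt.comp x (hn.log hne).neg)
      refine h1.congr_of_eventuallyEq ?_
      filter_upwards [isOpen_ne.mem_nhds hx] with y hy
      exact if_neg hy
  · exact HasCompactSupport.of_support_subset_isCompact (isCompact_closedBall 0 b)
      fun x hx => mem_closedBall_zero_iff.2 (hab x hx).2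
  · intro x y h
    have h' : x = 0 ↔ y = 0 := by rw [← norm_eq_zero, h, norm_eq_zero]
    simp only [emdenFowlerFun, h, h']

/-- The transform `T_k : C_c^k(ℝ) → C_{c,r}^k(ℝⁿ \ {0})`. -/
def emdenFowler (n k : ℕ) (α p : ℝ) (g : lineTest k) : RadialSpace n k α p :=
  ⟨emdenFowlerFun n k α p g.1, emdenFowlerFun_mem n k α p g⟩

end

/-! Put s = -log|x| and D = d/ds. If u(x) = |x|^{-H} g(s), then Δu has the same shape with H + 2 in
place of H and (D + H + 2 - n)(D + H)g in place of g. Likewise |∇u| is |x|^{-(H+1)} |(D + H)g|.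
Starting from H = H_{α,k}, the field ∇^k u therefore has modulus |x|^{-(n+α)/p} |Pg(s)|, where P =
∏(D + a_i) is a product of k first order factors with constant real coefficients. The final exponent
is the one at which weight and Jacobian cancel, so ‖T_k g‖_{k,α} is exactly a positive constant
times ‖Pg‖_p. The two coefficients contributed by one Laplacian multiply to -γ_{α,h}, and a final
gradient contributes H_{α,1}. Hence c_{α,k,p} > 0 forces every a_i to be nonzero.

It remains to compare ‖Pg‖_p with the Sobolev norm. Everything rests on |a| ‖g‖_p ≤ ‖g' + ag‖_p
(`abs_mul_lpn_le_lpn_shiftDeriv`), proved by pairing g' + ag with |g|^{p-2} g. Iterated over the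
factors, it bounds all derivatives up to order k by ‖Pg‖_p. Applied to D² - r² = (D - r)(D + r), it
also gives the interpolation inequality needed for the reverse bound.

Density of C_c^k in W^{k,p} avoids cutoffs and mollification of Sobolev functions. The range of such
a P on C_c^∞ is dense in L^p (`exists_lpn_sub_dOp_le`). So, for g in W^{k,p}, the weakly defined Pg
is a limit of Pφ_i; the a priori bound makes φ_i converge in W^{k,p}, and density of the range of
the adjoint in the dual L^q identifies the limit with g. The same convergence argument gives
completeness. Since T_k is bijective on test functions and bounded both ways, it extends to the
completions, uniquely by density. -/

/-! ### First order operators on test functions of the line -/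

/-- The `L^p` seminorm of a function on the line, as a real number. -/
noncomputable def lpn (p : ℝ) (f : ℝ → ℝ) : ℝ := (eLpNorm f (ENNReal.ofReal p) volume).toReal

/-- The operator `g ↦ g' + a g`. -/
noncomputable def shiftDeriv (a : ℝ) (g : ℝ → ℝ) : ℝ → ℝ := deriv g + a • g

/-- The composition of the operators `shiftDeriv a`, `a ∈ l`, the head of `l` being applied first. -/
noncomputable def dOp : List ℝ → (ℝ → ℝ) → ℝ → ℝ
  | [], g => g
  | a :: l, g => dOp l (shiftDeriv a g)

theorem dOp_append (l₁ l₂ : List ℝ) (g : ℝ → ℝ) : dOp (l₁ ++ l₂) g = dOp l₂ (dOp l₁ g) := by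
  induction l₁ generalizing g with
  | nil => rfl
  | cons a l ih => exact ih _

theorem lineTest_mono {j k : ℕ} (h : j ≤ k) {g : ℝ → ℝ} (hg : g ∈ lineTest k) : g ∈ lineTest j :=
  ⟨hg.1.of_le (by exact_mod_cast h), hg.2⟩

theorem mem_lineTest_of_smooth {g : ℝ → ℝ} (hg : ContDiff ℝ ∞ g) (hc : HasCompactSupport g)
    (k : ℕ) : g ∈ lineTest k :=
  ⟨hg.of_le (by exact_mod_cast le_top), hc⟩

theorem deriv_mem_lineTest {k : ℕ} {g : ℝ → ℝ} (hg : g ∈ lineTest (k + 1)) :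
    deriv g ∈ lineTest k := by
  have h : ContDiff ℝ ((k : WithTop ℕ∞) + 1) g := by exact_mod_cast hg.1
  exact ⟨(contDiff_succ_iff_deriv.1 h).2.2, hg.2.deriv⟩

theorem iteratedDeriv_mem_lineTest {j k : ℕ} {g : ℝ → ℝ} (hg : g ∈ lineTest (k + j)) :
    iteratedDeriv j g ∈ lineTest k := by
  induction j generalizing k with
  | zero => simpa using hg
  | succ j ih =>
    rw [iteratedDeriv_succ]
    exact deriv_mem_lineTest (ih (by convert hg using 2; ring))

theorem shiftDeriv_mem_lineTest {k : ℕ} (a : ℝ) {g : ℝ → ℝ} (hg : g ∈ lineTest (k + 1)) :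
    shiftDeriv a g ∈ lineTest k :=
  (lineTest k).add_mem (deriv_mem_lineTest hg)
    ((lineTest k).smul_mem a (lineTest_mono k.le_succ hg))

theorem dOp_mem_lineTest {k : ℕ} (l : List ℝ) {g : ℝ → ℝ} (hg : g ∈ lineTest (k + l.length)) :
    dOp l g ∈ lineTest k := by
  induction l generalizing g with
  | nil => exact hg
  | cons a l ih => exact ih (shiftDeriv_mem_lineTest a hg)

theorem lineTest_differentiable {k : ℕ} {g : ℝ → ℝ} (hg : g ∈ lineTest (k + 1)) :
    Differentiable ℝ g :=
  hg.1.differentiable (by simp)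

theorem shiftDeriv_smooth (a : ℝ) {g : ℝ → ℝ} (hg : ContDiff ℝ ∞ g) (hc : HasCompactSupport g) :
    ContDiff ℝ ∞ (shiftDeriv a g) ∧ HasCompactSupport (shiftDeriv a g) :=
  ⟨(contDiff_infty_iff_deriv.1 hg).2.add (contDiff_const.smul hg),
    hc.deriv.add (hc.smul_left (f := fun _ => a))⟩

theorem dOp_smooth (l : List ℝ) {g : ℝ → ℝ} (hg : ContDiff ℝ ∞ g) (hc : HasCompactSupport g) :
    ContDiff ℝ ∞ (dOp l g) ∧ HasCompactSupport (dOp l g) := by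
  induction l generalizing g with
  | nil => exact ⟨hg, hc⟩
  | cons a l ih => exact ih (shiftDeriv_smooth a hg hc).1 (shiftDeriv_smooth a hg hc).2

theorem shiftDeriv_add (a : ℝ) {f g : ℝ → ℝ} (hf : Differentiable ℝ f) (hg : Differentiable ℝ g) :
    shiftDeriv a (f + g) = shiftDeriv a f + shiftDeriv a g := by
  ext s
  simp only [shiftDeriv, Pi.add_apply, Pi.smul_apply, smul_eq_mul, deriv_add (hf s) (hg s)]
  ring

theorem shiftDeriv_smul (a c : ℝ) {f : ℝ → ℝ} (hf : Differentiable ℝ f) :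
    shiftDeriv a (c • f) = c • shiftDeriv a f := by
  ext s
  simp only [shiftDeriv, Pi.add_apply, Pi.smul_apply, smul_eq_mul, deriv_const_smul c (hf s)]
  ring

theorem dOp_add {l : List ℝ} {f g : ℝ → ℝ} (hf : f ∈ lineTest l.length)
    (hg : g ∈ lineTest l.length) : dOp l (f + g) = dOp l f + dOp l g := by
  induction l generalizing f g with
  | nil => rfl
  | cons a l ih =>
    rw [dOp, shiftDeriv_add a (lineTest_differentiable hf) (lineTest_differentiable hg)]
    exact ih (shiftDeriv_mem_lineTest a hf) (shiftDeriv_mem_lineTest a hg)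

theorem dOp_smul {l : List ℝ} (c : ℝ) {f : ℝ → ℝ} (hf : f ∈ lineTest l.length) :
    dOp l (c • f) = c • dOp l f := by
  induction l generalizing f with
  | nil => rfl
  | cons a l ih =>
    rw [dOp, shiftDeriv_smul a c (lineTest_differentiable hf)]
    exact ih (shiftDeriv_mem_lineTest a hf)

theorem iteratedDeriv_shiftDeriv (a : ℝ) {j : ℕ} {g : ℝ → ℝ} (hg : g ∈ lineTest (j + 1)) :
    iteratedDeriv j (shiftDeriv a g) = shiftDeriv a (iteratedDeriv j g) := by
  ext s
  have h1 : ContDiffAt ℝ j (deriv g) s := (deriv_mem_lineTest hg).1.contDiffAt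
  have h2 : ContDiffAt ℝ j g s := (lineTest_mono j.le_succ hg).1.contDiffAt
  rw [shiftDeriv, iteratedDeriv_add h1 (show ContDiffAt ℝ j (a • g) s from h2.const_smul a), shiftDeriv, Pi.add_apply,
    iteratedDeriv_const_smul_field, ← iteratedDeriv_succ', iteratedDeriv_succ]
  rfl

/-! ### `L^p` estimates -/

theorem lpn_nonneg (p : ℝ) (f : ℝ → ℝ) : 0 ≤ lpn p f := ENNReal.toReal_nonneg

theorem lineTest_memLp' {f : ℝ → ℝ} (hf : f ∈ lineTest 0) (p : ℝ) :
    MemLp f (ENNReal.ofReal p) volume :=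
  hf.1.continuous.memLp_of_hasCompactSupport hf.2

theorem lpn_add_le {p : ℝ} (hp : 1 < p) {f g : ℝ → ℝ} (hf : f ∈ lineTest 0) (hg : g ∈ lineTest 0) :
    lpn p (f + g) ≤ lpn p f + lpn p g := by
  have mf := lineTest_memLp' hf p
  have mg := lineTest_memLp' hg p
  rw [lpn, lpn, lpn, ← ENNReal.toReal_add mf.eLpNorm_ne_top mg.eLpNorm_ne_top]
  exact ENNReal.toReal_mono (ENNReal.add_ne_top.2 ⟨mf.eLpNorm_ne_top, mg.eLpNorm_ne_top⟩)
    (eLpNorm_add_le mf.1 mg.1 (by simpa using hp.le))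

theorem lpn_smul (p c : ℝ) (f : ℝ → ℝ) : lpn p (c • f) = |c| * lpn p f := by
  rw [lpn, eLpNorm_const_smul, ENNReal.toReal_mul]
  simp [lpn]

theorem lpn_neg (p : ℝ) (f : ℝ → ℝ) : lpn p (-f) = lpn p f := by
  rw [lpn, eLpNorm_neg, lpn]

theorem lpn_sub_le {p : ℝ} (hp : 1 < p) {f g : ℝ → ℝ} (hf : f ∈ lineTest 0) (hg : g ∈ lineTest 0) :
    lpn p (f - g) ≤ lpn p f + lpn p g := by
  rw [sub_eq_add_neg, ← lpn_neg p g]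
  exact lpn_add_le hp hf ((lineTest 0).neg_mem hg)

theorem lpn_eq_integral {p : ℝ} (hp : 1 < p) {f : ℝ → ℝ} (hf : f ∈ lineTest 0) :
    lpn p f = (∫ s, |f s| ^ p) ^ (1 / p) := by
  have hp0 : 0 < p := by linarith
  rw [lpn, (lineTest_memLp' hf p).eLpNorm_eq_integral_rpow_norm (by simpa using hp0)
    ENNReal.ofReal_ne_top, ENNReal.toReal_ofReal hp0.le, ENNReal.toReal_ofReal (by positivity),
    one_div]
  rfl

/-- Multiply g' + ag by |g|^{p-2} g and integrate: the term with g' is the derivative of |g|^p / p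
and integrates to zero, leaving a ∫|g|^p. Hölder's inequality bounds the result by ‖g' + ag‖_p
‖g‖_p^{p-1}. -/
theorem abs_mul_lpn_le_lpn_shiftDeriv {p : ℝ} (hp : 1 < p) (a : ℝ) {g : ℝ → ℝ}
    (hg : g ∈ lineTest 1) : |a| * lpn p g ≤ lpn p (shiftDeriv a g) := by
  have hp0 : 0 < p := by linarith
  have hg0 : g ∈ lineTest 0 := lineTest_mono zero_le_one hg
  have hh : shiftDeriv a g ∈ lineTest 0 := shiftDeriv_mem_lineTest a hg
  have hpq := Real.HolderConjugate.conjExponent hp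
  set q := Real.conjExponent p with hq
  have hq1 : 1 < q := hpq.symm.lt
  have hpow : ∀ t : ℝ, (|t| ^ (p - 1)) ^ q = |t| ^ p := by
    intro t
    rw [← Real.rpow_mul (abs_nonneg t), hpq.sub_one_mul_conj]
  have cont_abs : Continuous fun s => |g s| ^ (p - 1) :=
    (hg.1.continuous.abs).rpow_const fun _ => Or.inr (by linarith)
  have supp_abs : ∀ r : ℝ, 0 < r → HasCompactSupport fun s => |g s| ^ r := fun r hr =>
    hg.2.comp_left (g := fun t : ℝ => |t| ^ r) (by simp [Real.zero_rpow hr.ne'])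
  have mabs : MemLp (fun s => |g s| ^ (p - 1)) (ENNReal.ofReal q) volume :=
    cont_abs.memLp_of_hasCompactSupport (supp_abs _ (by linarith))
  have hderiv : ∀ s, HasDerivAt (fun s => |g s| ^ p) (p * |g s| ^ (p - 2) * g s * deriv g s) s :=
    fun s => (hasDerivAt_abs_rpow (g s) hp).comp s (lineTest_differentiable hg s).hasDerivAt
  have habs : ∀ t : ℝ, |(|t| ^ (p - 2) * t)| = |t| ^ (p - 1) := by
    intro t
    rcases eq_or_ne t 0 with rfl | ht
    · simp [Real.zero_rpow (by linarith : p - 1 ≠ 0)]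
    · have h : 0 < |t| := abs_pos.2 ht
      rw [abs_mul, abs_of_nonneg (by positivity : 0 ≤ |t| ^ (p - 2)),
        show p - 1 = (p - 2) + 1 by ring, Real.rpow_add_one h.ne']
  have hsq : ∀ t : ℝ, |t| ^ (p - 2) * t * t = |t| ^ p := by
    intro t
    rcases eq_or_ne t 0 with rfl | ht
    · simp [Real.zero_rpow hp0.ne']
    · have h : 0 < |t| := abs_pos.2 ht
      have e : |t| ^ p = |t| ^ (p - 2) * |t| * |t| := by
        rw [← Real.rpow_add_one h.ne', ← Real.rpow_add_one h.ne']
        congr 1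
        ring
      rw [e, mul_assoc, mul_assoc, abs_mul_abs_self]
  have meas : AEStronglyMeasurable (fun s => |g s| ^ (p - 2) * g s) volume := by
    have := hg.1.continuous.measurable
    exact (by fun_prop : Measurable fun s => |g s| ^ (p - 2) * g s).aestronglyMeasurable
  -- For p < 2 the factor |g|^{p-2} is singular at the zeros of g, so integrability comes from
  -- measurability and domination by the continuous |g|^{p-1} |u|.
  have int1 : ∀ u ∈ lineTest 0, Integrable (fun s => |g s| ^ (p - 2) * g s * u s) := by
    intro u hu
    have : Integrable fun s => |g s| ^ (p - 1) * u s :=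
      (cont_abs.mul hu.1.continuous).integrable_of_hasCompactSupport
        ((supp_abs (p - 1) (by linarith)).mul_right)
    refine this.mono (meas.mul hu.1.continuous.aestronglyMeasurable) (Eventually.of_forall ?_)
    intro s
    rw [norm_mul, Real.norm_eq_abs, habs, norm_mul, Real.norm_eq_abs (_ ^ _),
      abs_of_nonneg (by positivity : (0:ℝ) ≤ |g s| ^ (p - 1))]
  have hint0 : ∫ s, p * (|g s| ^ (p - 2) * g s * deriv g s) = 0 := by
    refine integral_eq_zero_of_hasDerivAt_of_integrable (f := fun s => |g s| ^ p)
      (fun s => ?_) ((int1 _ (deriv_mem_lineTest hg)).const_mul p) ?_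
    · exact (hderiv s).congr_deriv (by ring)
    · exact (hg.1.continuous.abs.rpow_const fun _ => Or.inr hp0.le).integrable_of_hasCompactSupport
        (supp_abs p hp0)
  rw [integral_const_mul] at hint0
  have hint1 : ∫ s, |g s| ^ (p - 2) * g s * deriv g s = 0 := by
    rcases mul_eq_zero.1 hint0 with h | h
    · exact absurd h hp0.ne'
    · exact h
  set X := ∫ s, |g s| ^ p with hX
  have hX0 : 0 ≤ X := integral_nonneg fun s => by positivity
  have key : a * X = ∫ s, |g s| ^ (p - 2) * g s * shiftDeriv a g s := by
    have e : ∀ s, |g s| ^ (p - 2) * g s * shiftDeriv a g s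
        = |g s| ^ (p - 2) * g s * deriv g s + a * |g s| ^ p := by
      intro s
      rw [← hsq (g s)]
      simp only [shiftDeriv, Pi.add_apply, Pi.smul_apply, smul_eq_mul]
      ring
    simp_rw [e]
    rw [integral_add (int1 _ (deriv_mem_lineTest hg)), hint1, integral_const_mul, zero_add]
    refine Integrable.const_mul ?_ a
    exact (hg.1.continuous.abs.rpow_const fun _ => Or.inr hp0.le).integrable_of_hasCompactSupport
        (supp_abs p hp0)
  have holder := integral_mul_le_Lp_mul_Lq_of_nonneg (μ := volume) hpq
    (f := fun s => |shiftDeriv a g s|) (g := fun s => |g s| ^ (p - 1))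
    (Eventually.of_forall fun s => abs_nonneg _) (Eventually.of_forall fun s => by positivity)
    (lineTest_memLp' hh p).abs mabs
  simp only [hpow, ← hX] at holder
  rw [← lpn_eq_integral hp hh] at holder
  have step : |a| * X ≤ lpn p (shiftDeriv a g) * X ^ (1 / q) := by
    refine le_trans ?_ holder
    rw [← abs_of_nonneg hX0, ← abs_mul, key]
    refine (abs_integral_le_integral_abs).trans (le_of_eq ?_)
    congr 1
    ext s
    rw [abs_mul, habs, mul_comm]
  rw [lpn_eq_integral hp hg0, ← hX]
  rcases hX0.eq_or_lt with h | h
  · rw [← h, Real.zero_rpow (by positivity), mul_zero]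
    exact lpn_nonneg _ _
  · have hXq : 0 < X ^ (1 / q) := Real.rpow_pos_of_pos h _
    -- Since X ≠ 0 here, splitting X by 1/p + 1/q = 1 lets the Hölder factor X^{1/q} cancel.
    have : X = X ^ (1 / p) * X ^ (1 / q) := by
      rw [← Real.rpow_add h, one_div, one_div, hpq.inv_add_inv_eq_one, Real.rpow_one]
    refine le_of_mul_le_mul_right ?_ hXq
    calc |a| * X ^ (1 / p) * X ^ (1 / q) = |a| * X := by rw [mul_assoc, ← this]
      _ ≤ _ := step

/-- Triangle inequality for g' = (g' + ag) - ag. The constant does not depend on a, which the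
interpolation inequality exploits by letting a vary. -/
theorem lpn_deriv_le_lpn_shiftDeriv {p : ℝ} (hp : 1 < p) (a : ℝ) {g : ℝ → ℝ}
    (hg : g ∈ lineTest 1) : lpn p (deriv g) ≤ 2 * lpn p (shiftDeriv a g) := by
  have hg0 : g ∈ lineTest 0 := lineTest_mono zero_le_one hg
  have e : deriv g = shiftDeriv a g - a • g := by simp [shiftDeriv]
  have h := lpn_sub_le hp (shiftDeriv_mem_lineTest a hg) ((lineTest 0).smul_mem a hg0)
  rw [← e, lpn_smul] at h
  linarith [abs_mul_lpn_le_lpn_shiftDeriv hp a hg]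

/-- A product of invertible first order operators controls all derivatives. -/
theorem exists_lpn_iteratedDeriv_le {p : ℝ} (hp : 1 < p) (l : List ℝ) (hl : ∀ a ∈ l, a ≠ 0) :
    ∃ C, 0 ≤ C ∧ ∀ g ∈ lineTest l.length, ∀ j ≤ l.length,
      lpn p (iteratedDeriv j g) ≤ C * lpn p (dOp l g) := by
  induction l with
  | nil =>
    refine ⟨1, zero_le_one, fun g _ j hj => ?_⟩
    obtain rfl : j = 0 := by simpa using hj
    simp [dOp]
  | cons a l ih =>
    obtain ⟨C, hC, h⟩ := ih fun b hb => hl b (List.mem_cons_of_mem _ hb)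
    have ha : 0 < |a| := abs_pos.2 (hl a List.mem_cons_self)
    -- The factor |a|⁻¹ pays for g itself. The factor 2 pays for derivatives of order i + 1,
    -- obtained from the i-th derivative of g' + ag because differentiation commutes with D + a.
    refine ⟨(2 + |a|⁻¹) * C, by positivity, fun g hg j hj => ?_⟩
    have hf := shiftDeriv_mem_lineTest a hg
    have key : ∀ i ≤ l.length, lpn p (iteratedDeriv i (shiftDeriv a g)) ≤ C * lpn p (dOp (a :: l) g) :=
      fun i hi => h _ hf i hi
    have hN := lpn_nonneg p (dOp (a :: l) g)
    cases j with
    | zero =>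
      have h1 := key 0 (Nat.zero_le _)
      have h2 := abs_mul_lpn_le_lpn_shiftDeriv hp a
        (lineTest_mono (show 1 ≤ (a :: l).length by simp) hg)
      rw [iteratedDeriv_zero] at h1 ⊢
      have h3 : lpn p g ≤ |a|⁻¹ * (C * lpn p (dOp (a :: l) g)) := by
        rw [← div_eq_inv_mul, le_div_iff₀ ha, mul_comm]
        exact h2.trans h1
      nlinarith [mul_nonneg hC hN]
    | succ i =>
      have hi : i ≤ l.length := by simpa using hj
      have hgi : g ∈ lineTest (i + 1) := lineTest_mono hj hg
      have h1 := key i hi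
      rw [iteratedDeriv_shiftDeriv a hgi] at h1
      have h2 := lpn_deriv_le_lpn_shiftDeriv hp a
        (iteratedDeriv_mem_lineTest (k := 1) (j := i) (by rwa [add_comm]))
      rw [iteratedDeriv_succ]
      have : 0 ≤ |a|⁻¹ * (C * lpn p (dOp (a :: l) g)) := by positivity
      nlinarith

/-! ### Interpolation of derivatives -/

/-- With r = 1/t, factor D² - r² = (D - r)(D + r). The first order estimates give ‖g'‖ ≤ 2‖(D + r)g‖
≤ 2t‖g'' - r²g‖. -/
theorem lpn_deriv_le_interpolation {p : ℝ} (hp : 1 < p) {t : ℝ} (ht : 0 < t) {g : ℝ → ℝ}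
    (hg : g ∈ lineTest 2) :
    lpn p (deriv g) ≤ 2 * t * lpn p (deriv (deriv g)) + 2 / t * lpn p g := by
  set r := t⁻¹ with hr
  have hr0 : 0 < r := inv_pos.2 ht
  have hg1 : g ∈ lineTest 1 := lineTest_mono one_le_two hg
  have hf : shiftDeriv r g ∈ lineTest 1 := shiftDeriv_mem_lineTest r hg
  have h1 := lpn_deriv_le_lpn_shiftDeriv hp r hg1
  have h2 := abs_mul_lpn_le_lpn_shiftDeriv hp (-r) hf
  have e : shiftDeriv (-r) (shiftDeriv r g) = deriv (deriv g) + (-(r * r)) • g := by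
    ext s
    have hd : deriv (shiftDeriv r g) s = deriv (deriv g) s + r * deriv g s := by
      rw [shiftDeriv, deriv_add (lineTest_differentiable (deriv_mem_lineTest hg) s)
        ((lineTest_differentiable hg1 s).const_smul r),
        deriv_const_smul r (lineTest_differentiable hg1 s)]
      rfl
    rw [shiftDeriv, Pi.add_apply, hd]
    simp only [shiftDeriv, Pi.add_apply, Pi.smul_apply, smul_eq_mul]
    ring
  have h3 := lpn_add_le hp (deriv_mem_lineTest (deriv_mem_lineTest hg))
    ((lineTest 0).smul_mem (-(r * r)) (lineTest_mono zero_le_two hg))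
  rw [e] at h2
  rw [lpn_smul, abs_neg, abs_of_pos (mul_pos hr0 hr0)] at h3
  rw [abs_neg, abs_of_pos hr0] at h2
  have h4 : lpn p (shiftDeriv r g) ≤ t * (lpn p (deriv (deriv g)) + r * r * lpn p g) := by
    have := h2.trans h3
    rw [hr, ← div_eq_inv_mul, div_le_iff₀ ht, mul_comm] at this
    exact this
  refine h1.trans ((mul_le_mul_of_nonneg_left h4 zero_le_two).trans (le_of_eq ?_))
  rw [hr]
  field_simp

theorem exists_lpn_iteratedDeriv_le_eps {p : ℝ} (hp : 1 < p) (k : ℕ) :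
    ∀ ε > 0, ∃ C, 0 ≤ C ∧ ∀ g ∈ lineTest (k + 1),
      lpn p (iteratedDeriv k g) ≤ ε * lpn p (iteratedDeriv (k + 1) g) + C * lpn p g := by
  induction k with
  | zero =>
    intro ε hε
    refine ⟨1, zero_le_one, fun g _ => ?_⟩
    have := mul_nonneg hε.le (lpn_nonneg p (iteratedDeriv (0 + 1) g))
    rw [iteratedDeriv_zero]
    linarith
  | succ k ih =>
    intro ε hε
    -- Interpolating with t = ε/4 multiplies the derivative of order k by 8/ε. The choice ε/16
    -- leaves half of the derivative of order k + 1 on the right, to be absorbed on the left.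
    obtain ⟨C, hC, h⟩ := ih (ε / 16) (by positivity)
    refine ⟨16 / ε * C, by positivity, fun g hg => ?_⟩
    have h1 := lpn_deriv_le_interpolation hp (t := ε / 4) (by positivity)
      (iteratedDeriv_mem_lineTest (k := 2) (j := k) (g := g)
        (by convert hg using 2; ring))
    have h2 := h g (lineTest_mono (Nat.le_succ _) hg)
    rw [← iteratedDeriv_succ, ← iteratedDeriv_succ] at h1
    have h3 : 2 / (ε / 4) * lpn p (iteratedDeriv k g)
        ≤ 2 / (ε / 4) * (ε / 16 * lpn p (iteratedDeriv (k + 1) g) + C * lpn p g) := by gcongr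
    have h4 : 2 / (ε / 4) * (ε / 16 * lpn p (iteratedDeriv (k + 1) g) + C * lpn p g)
        = 1 / 2 * lpn p (iteratedDeriv (k + 1) g) + 1 / 2 * (16 / ε * C * lpn p g) := by
      field_simp
      ring
    linarith

theorem exists_lpn_iteratedDeriv_le_add {p : ℝ} (hp : 1 < p) (k : ℕ) :
    ∃ C, 0 ≤ C ∧ ∀ g ∈ lineTest k, ∀ j ≤ k,
      lpn p (iteratedDeriv j g) ≤ C * (lpn p (iteratedDeriv k g) + lpn p g) := by
  induction k with
  | zero =>
    refine ⟨1, zero_le_one, fun g _ j hj => ?_⟩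
    obtain rfl : j = 0 := by simpa using hj
    linarith [lpn_nonneg p g]
  | succ k ih =>
    obtain ⟨C, hC, h⟩ := ih
    obtain ⟨B, hB, h'⟩ := exists_lpn_iteratedDeriv_le_eps hp k 1 one_pos
    refine ⟨C * (1 + B) + 1, by positivity, fun g hg j hj => ?_⟩
    have n1 := lpn_nonneg p (iteratedDeriv (k + 1) g)
    have n2 := lpn_nonneg p g
    rcases Nat.lt_or_eq_of_le hj with hj | rfl
    · have h1 := h g (lineTest_mono k.le_succ hg) j (by omega)
      have h2 := mul_le_mul_of_nonneg_left (h' g hg) hC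
      have : 0 ≤ C * B * lpn p (iteratedDeriv (k + 1) g) := by positivity
      nlinarith
    · have : 0 ≤ C * (1 + B) * (lpn p (iteratedDeriv (k + 1) g) + lpn p g) := by positivity
      linarith

/-- A common bound B on all derivatives is what passes through the induction: one factor D + a turns
it into (1 + |a|)B. -/
theorem exists_lpn_dOp_le {p : ℝ} (hp : 1 < p) (l : List ℝ) :
    ∃ C, 0 ≤ C ∧ ∀ g ∈ lineTest l.length, ∀ B,
      (∀ j ≤ l.length, lpn p (iteratedDeriv j g) ≤ B) → lpn p (dOp l g) ≤ C * B := by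
  induction l with
  | nil =>
    refine ⟨1, zero_le_one, fun g _ B h => ?_⟩
    simpa [dOp] using h 0 le_rfl
  | cons a l ih =>
    obtain ⟨C, hC, h⟩ := ih
    refine ⟨C * (1 + |a|), by positivity, fun g hg B hB => ?_⟩
    rw [mul_assoc]
    refine h _ (shiftDeriv_mem_lineTest a hg) _ fun j hj => ?_
    have hg' : g ∈ lineTest (j + 1) := lineTest_mono (by simpa using hj) hg
    rw [iteratedDeriv_shiftDeriv a hg', shiftDeriv, ← iteratedDeriv_succ]
    have h1 := lpn_add_le hp (iteratedDeriv_mem_lineTest (k := 0) (j := j + 1) (g := g)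
      (by simpa using hg')) ((lineTest 0).smul_mem a (iteratedDeriv_mem_lineTest (k := 0) (j := j)
      (g := g) (by simpa using lineTest_mono j.le_succ hg')))
    rw [lpn_smul] at h1
    have h2 := hB (j + 1) (by simpa using hj)
    have h3 := mul_le_mul_of_nonneg_left (hB j (by simp; omega)) (abs_nonneg a)
    linarith

/-! ### Density of the range of `dOp` on test functions -/

/-- Integrating factor: φ(s) = e^{-as} ∫_A^s e^{at} f(t) dt. It vanishes to the left of the support
of f, and to its right exactly because the total integral is zero. -/
theorem exists_shiftDeriv_eq (a : ℝ) {f : ℝ → ℝ} (hf : ContDiff ℝ ∞ f) (hc : HasCompactSupport f)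
    (h0 : ∫ t, Real.exp (a * t) * f t = 0) :
    ∃ φ, ContDiff ℝ ∞ φ ∧ HasCompactSupport φ ∧ shiftDeriv a φ = f := by
  obtain ⟨R, hR⟩ := hc.isBounded.subset_closedBall 0
  have hsupp : ∀ t, f t ≠ 0 → -R ≤ t ∧ t ≤ R := fun t ht => by
    have := hR (subset_tsupport f ht)
    rwa [mem_closedBall_zero_iff, Real.norm_eq_abs, abs_le] at this
  set w : ℝ → ℝ := fun t => Real.exp (a * t) * f t with hw
  have hws : ContDiff ℝ ∞ w := by fun_prop
  have hwsupp : ∀ t, w t ≠ 0 → -R ≤ t ∧ t ≤ R := fun t ht =>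
    hsupp t fun h => ht (by simp [hw, h])
  -- Strictly below -R, so that the half-open interval from A contains the whole support.
  set A := -R - 1 with hA
  set F : ℝ → ℝ := fun s => ∫ t in A..s, w t with hF
  have hFd : ∀ s, HasDerivAt F (w s) s := fun s =>
    intervalIntegral.integral_hasDerivAt_right (hws.continuous.intervalIntegrable _ _)
      (hws.continuous.stronglyMeasurableAtFilter _ _) hws.continuous.continuousAt
  have hFs : ContDiff ℝ ∞ F := by
    refine contDiff_infty_iff_deriv.2 ⟨fun s => (hFd s).differentiableAt, ?_⟩
    rwa [show deriv F = w from funext fun s => (hFd s).deriv]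
  have hFsupp : ∀ s, s ∉ Icc (-R) R → F s = 0 := by
    intro s hs
    rw [mem_Icc, not_and_or, not_le, not_le] at hs
    rcases hs with hs | hs
    · refine (intervalIntegral.integral_congr (g := fun _ => 0) fun t ht => ?_).trans (by simp)
      by_contra h
      have h1 := hwsupp t h
      rcases le_total A s with h2 | h2
      · rw [uIcc_of_le h2] at ht
        linarith [ht.2]
      · rw [uIcc_of_ge h2] at ht
        linarith [ht.2]
    · rw [hF, ← h0]
      refine intervalIntegral.integral_eq_integral_of_support_subset fun t ht => ?_
      have := hwsupp t ht
      exact ⟨by linarith, by linarith⟩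
  refine ⟨fun s => Real.exp (-(a * s)) * F s, by fun_prop, ?_, ?_⟩
  · refine HasCompactSupport.of_support_subset_isCompact (isCompact_Icc (a := -R) (b := R)) ?_
    intro s hs
    by_contra h
    exact hs (by simp [hFsupp s h])
  · ext s
    have h1 : HasDerivAt (fun s => Real.exp (-(a * s))) (Real.exp (-(a * s)) * (-a)) s := by
      simpa using ((hasDerivAt_id s).const_mul a).neg.exp
    have h2 := (h1.mul (hFd s)).deriv
    simp only [shiftDeriv, Pi.add_apply, Pi.smul_apply, smul_eq_mul]
    rw [show (fun s => Real.exp (-(a * s)) * F s) = (fun s => Real.exp (-(a * s))) * F from rfl, h2]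
    have h3 : Real.exp (-(a * s)) * w s = f s := by
      rw [hw, ← mul_assoc, ← Real.exp_add]
      simp
    linear_combination h3

theorem lpn_comp_sub {f : ℝ → ℝ} (p τ : ℝ) (hf : AEStronglyMeasurable f volume) :
    lpn p (fun s => f (s - τ)) = lpn p f := by
  rw [lpn, lpn]
  congr 1
  exact eLpNorm_comp_measurePreserving hf (measurePreserving_sub_right volume τ)

/-- The only obstruction to solving φ' + aφ = f is the number ∫ e^{at} f. A bump translated to where
e^{at} is huge cancels it with a tiny coefficient. Translation does not change L^p norms, so the
correction is small with all its derivatives up to order m. -/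
theorem exists_lpn_sub_shiftDeriv_le (p : ℝ) {a : ℝ} (ha : a ≠ 0) (m : ℕ) {f : ℝ → ℝ}
    (hf : ContDiff ℝ ∞ f) (hc : HasCompactSupport f) {ε : ℝ} (hε : 0 < ε) :
    ∃ φ, ContDiff ℝ ∞ φ ∧ HasCompactSupport φ ∧
      ∀ j ≤ m, lpn p (iteratedDeriv j (f - shiftDeriv a φ)) ≤ ε := by
  let ψ : ContDiffBump (0 : ℝ) := default
  have hψ : ContDiff ℝ ∞ ψ := ψ.contDiff
  have hψc : HasCompactSupport ψ := ψ.hasCompactSupport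
  set I := ∫ t, Real.exp (a * t) * ψ t with hI
  have hexp : Continuous fun t => Real.exp (a * t) := by fun_prop
  have hI0 : 0 < I := by
    refine (hexp.mul hψ.continuous).integral_pos_of_hasCompactSupport_nonneg_nonzero
      hψc.mul_left (fun t => mul_nonneg (Real.exp_pos _).le ψ.nonneg) (x := 0) ?_
    have h : ψ 0 = 1 := ψ.one_of_mem_closedBall (Metric.mem_closedBall_self ψ.rIn_pos.le)
    simp [h]
  set c := (∫ t, Real.exp (a * t) * f t) / I with hcdef
  set K := ∑ j ∈ Finset.range (m + 1), |c| * lpn p (iteratedDeriv j ψ) with hK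
  have hlim : Tendsto (fun M : ℝ => Real.exp (-(a * (a * M))) * K) atTop (𝓝 0) := by
    have h1 : Tendsto (fun M : ℝ => a * (a * M)) atTop atTop := by
      simp_rw [← mul_assoc]
      exact tendsto_id.const_mul_atTop (mul_self_pos.2 ha)
    simpa using (Real.tendsto_exp_neg_atTop_nhds_zero.comp h1).mul_const K
  obtain ⟨M, hM⟩ := (hlim.eventually (gt_mem_nhds hε)).exists
  -- Then aτ = a²M tends to +∞ with M, whatever the sign of a.
  set τ := a * M with hτ
  set C := Real.exp (-(a * τ)) * c with hC
  set ψτ : ℝ → ℝ := fun s => ψ (s - τ) with hψτ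
  have hψτs : ContDiff ℝ ∞ ψτ := hψ.comp (contDiff_id.sub contDiff_const)
  have hψτc : HasCompactSupport ψτ :=
    hψc.comp_homeomorph (Homeomorph.subRight τ)
  have hIτ : ∫ t, Real.exp (a * t) * ψτ t = Real.exp (a * τ) * I := by
    rw [hI, ← integral_const_mul,
      ← integral_sub_right_eq_self (fun t => Real.exp (a * τ) * (Real.exp (a * t) * ψ t)) τ]
    congr 1
    ext t
    rw [← mul_assoc, ← Real.exp_add]
    congr 2
    ring
  have hsol : ∫ t, Real.exp (a * t) * (f - C • ψτ) t = 0 := by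
    have e : ∀ t, Real.exp (a * t) * (f - C • ψτ) t
        = Real.exp (a * t) * f t - C * (Real.exp (a * t) * ψτ t) := fun t => by
      simp only [Pi.sub_apply, Pi.smul_apply, smul_eq_mul]
      ring
    have i₁ : Integrable fun t => Real.exp (a * t) * f t :=
      (hexp.mul hf.continuous).integrable_of_hasCompactSupport hc.mul_left
    have i₂ : Integrable fun t => Real.exp (a * t) * ψτ t :=
      (hexp.mul hψτs.continuous).integrable_of_hasCompactSupport hψτc.mul_left
    simp_rw [e]
    rw [integral_sub i₁ (i₂.const_mul C),
      integral_const_mul, hIτ, hC]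
    have h1 : Real.exp (-(a * τ)) * Real.exp (a * τ) = 1 := by
      rw [← Real.exp_add]
      simp
    have h2 : c * I = ∫ t, Real.exp (a * t) * f t := div_mul_cancel₀ _ hI0.ne'
    linear_combination -h2 - c * I * h1
  obtain ⟨φ, hφ, hφc, e⟩ := exists_shiftDeriv_eq a (f := f - C • ψτ)
    (hf.sub (contDiff_const.smul hψτs)) (hc.sub (hψτc.smul_left (f := fun _ => C))) hsol
  refine ⟨φ, hφ, hφc, fun j hj => ?_⟩
  have e' : iteratedDeriv j (f - shiftDeriv a φ) = C • fun s => iteratedDeriv j ψ (s - τ) := by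
    rw [e, sub_sub_cancel]
    ext s
    rw [iteratedDeriv_const_smul_field, hψτ, iteratedDeriv_comp_sub_const]
    rfl
  have hcont := (lineTest_iteratedDeriv le_rfl ⟨ψ, mem_lineTest_of_smooth hψ hψc j⟩).1
  rw [e', lpn_smul, lpn_comp_sub p τ hcont.aestronglyMeasurable, hC, abs_mul,
    abs_of_pos (Real.exp_pos _), mul_assoc]
  refine le_trans ?_ hM.le
  refine mul_le_mul_of_nonneg_left ?_ (Real.exp_pos _).le
  exact Finset.single_le_sum (f := fun j => |c| * lpn p (iteratedDeriv j ψ))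
    (fun j _ => mul_nonneg (abs_nonneg _) (lpn_nonneg _ _)) (Finset.mem_range.2 (by omega))

/-- Peel off one factor: f is close to `dOp l f₁`, and f₁ is close to φ' + aφ together with its
derivatives up to the order of `dOp l`, so applying `dOp l` keeps the second error small. -/
theorem exists_lpn_sub_dOp_le {p : ℝ} (hp : 1 < p) {l : List ℝ} (hl : ∀ a ∈ l, a ≠ 0)
    {f : ℝ → ℝ} (hf : ContDiff ℝ ∞ f) (hc : HasCompactSupport f) {ε : ℝ} (hε : 0 < ε) :
    ∃ φ, ContDiff ℝ ∞ φ ∧ HasCompactSupport φ ∧ lpn p (f - dOp l φ) ≤ ε := by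
  induction l generalizing ε with
  | nil => exact ⟨f, hf, hc, by simpa [dOp, lpn] using hε.le⟩
  | cons a l ih =>
    obtain ⟨f₁, hf₁, hc₁, h₁⟩ := ih (fun b hb => hl b (List.mem_cons_of_mem _ hb)) (half_pos hε)
    obtain ⟨C, hC, hdOp⟩ := exists_lpn_dOp_le hp l
    -- Dividing by C + 1 rather than C allows C = 0.
    obtain ⟨φ, hφ, hφc, h₂⟩ := exists_lpn_sub_shiftDeriv_le p (hl a List.mem_cons_self) l.length
      hf₁ hc₁ (ε := ε / 2 / (C + 1)) (by positivity)
    refine ⟨φ, hφ, hφc, ?_⟩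
    have m₁ := mem_lineTest_of_smooth hf₁ hc₁ l.length
    obtain ⟨s₂, c₂⟩ := shiftDeriv_smooth a hφ hφc
    have m₂ := mem_lineTest_of_smooth s₂ c₂ l.length
    have h₃ := hdOp _ ((lineTest _).sub_mem m₁ m₂) _ h₂
    have e : f - dOp (a :: l) φ = (f - dOp l f₁) + dOp l (f₁ - shiftDeriv a φ) := by
      rw [sub_eq_add_neg f₁, ← neg_one_smul ℝ (shiftDeriv a φ),
        dOp_add m₁ ((lineTest _).smul_mem _ m₂), dOp_smul _ m₂, dOp, neg_one_smul]
      abel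
    have d₁ := dOp_smooth l hf₁ hc₁
    have h₄ := lpn_add_le hp
      ((lineTest 0).sub_mem (mem_lineTest_of_smooth hf hc 0) (mem_lineTest_of_smooth d₁.1 d₁.2 0))
      (dOp_mem_lineTest (k := 0) l
        (by simpa using (lineTest l.length).sub_mem m₁ m₂ : f₁ - shiftDeriv a φ ∈ _))
    rw [← e] at h₄
    have h₅ : C * (ε / 2 / (C + 1)) ≤ ε / 2 := by
      rw [mul_div_assoc', div_le_iff₀ (by positivity)]
      nlinarith
    linarith

/-! ### Hölder's inequality and passage to the limit in weak derivatives -/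

theorem abs_integral_mul_le_lpn_mul_lpn {p q : ℝ} (hpq : p.HolderConjugate q) {f g : ℝ → ℝ}
    (hf : MemLp f (ENNReal.ofReal p) volume) (hg : MemLp g (ENNReal.ofReal q) volume) :
    |∫ s, f s * g s| ≤ lpn p f * lpn q g := by
  have e : ∀ {r : ℝ} {u : ℝ → ℝ}, 0 < r → MemLp u (ENNReal.ofReal r) volume →
      lpn r u = (∫ s, ‖u s‖ ^ r) ^ (1 / r) := fun {r u} hr hu => by
    rw [lpn, hu.eLpNorm_eq_integral_rpow_norm (by simpa using hr) ENNReal.ofReal_ne_top,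
      ENNReal.toReal_ofReal hr.le, ENNReal.toReal_ofReal (by positivity), one_div]
  rw [e hpq.pos hf, e hpq.symm.pos hg]
  refine le_trans ?_ (integral_mul_norm_le_Lp_mul_Lq hpq hf hg)
  refine (abs_integral_le_integral_abs).trans (le_of_eq ?_)
  simp_rw [abs_mul]
  rfl

section

variable {p : ℝ} [Fact (1 < p)]

theorem LpLine.integral_sub_mul (f g : LpLine p) {φ : ℝ → ℝ} (hφ : Continuous φ)
    (hc : HasCompactSupport φ) :
    ∫ s, (f - g : LpLine p) s * φ s = (∫ s, f s * φ s) - ∫ s, g s * φ s := by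
  rw [← integral_sub (f.integrable_mul hφ hc) (g.integrable_mul hφ hc)]
  refine integral_congr_ae ?_
  filter_upwards [Lp.coeFn_sub f g] with s hs
  rw [hs, Pi.sub_apply, sub_mul]

theorem LpLine.abs_integral_mul_le {p q : ℝ} (hpq : p.HolderConjugate q) (f : LpLine p) {φ : ℝ → ℝ}
    (hφ : Continuous φ) (hc : HasCompactSupport φ) : |∫ s, f s * φ s| ≤ ‖f‖ * lpn q φ :=
  abs_integral_mul_le_lpn_mul_lpn hpq (Lp.memLp f) (hφ.memLp_of_hasCompactSupport hc)

theorem LpLine.tendsto_integral_mul {f : ℕ → LpLine p} {f₀ : LpLine p}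
    (h : Tendsto f atTop (𝓝 f₀)) {φ : ℝ → ℝ} (hφ : Continuous φ) (hc : HasCompactSupport φ) :
    Tendsto (fun i => ∫ s, f i s * φ s) atTop (𝓝 (∫ s, f₀ s * φ s)) := by
  have hpq := Real.HolderConjugate.conjExponent (Fact.out : 1 < p)
  rw [tendsto_iff_norm_sub_tendsto_zero] at h ⊢
  refine squeeze_zero (fun _ => norm_nonneg _) (fun i => ?_) (by simpa using h.mul_const (lpn p.conjExponent φ))
  rw [← LpLine.integral_sub_mul _ _ hφ hc]
  exact LpLine.abs_integral_mul_le hpq _ hφ hc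

theorem HasWeakDeriv.of_tendsto {j : ℕ} {f h : ℕ → LpLine p} {f₀ h₀ : LpLine p}
    (hf : Tendsto f atTop (𝓝 f₀)) (hh : Tendsto h atTop (𝓝 h₀))
    (H : ∀ i, HasWeakDeriv j (f i) (h i)) : HasWeakDeriv j f₀ h₀ := by
  intro φ hφ hc
  obtain ⟨hd, hdc⟩ := iteratedDeriv_test hφ hc j
  refine tendsto_nhds_unique (LpLine.tendsto_integral_mul hf hd.continuous hdc) ?_
  simp_rw [fun i => H i φ hφ hc]
  exact (LpLine.tendsto_integral_mul hh hφ.continuous hc).const_mul _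

theorem HasWeakDeriv.deriv_of_succ {j : ℕ} {f f' h : ℝ → ℝ} (H₁ : HasWeakDeriv 1 f f')
    (H : HasWeakDeriv (j + 1) f h) : HasWeakDeriv j f' h := by
  intro φ hφ hc
  obtain ⟨hd, hdc⟩ := iteratedDeriv_test hφ hc j
  have h₁ := H₁ _ hd hdc
  rw [iteratedDeriv_one, ← iteratedDeriv_succ, H φ hφ hc] at h₁
  rw [pow_succ] at h₁
  linear_combination h₁

theorem integral_shiftDeriv_neg {f f' φ : ℝ → ℝ} (a : ℝ) (H : HasWeakDeriv 1 f f')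
    (hφ : ContDiff ℝ ∞ φ) (hc : HasCompactSupport φ)
    (i₀ : ∀ ψ : ℝ → ℝ, Continuous ψ → HasCompactSupport ψ → Integrable fun s => f s * ψ s)
    (i₁ : ∀ ψ : ℝ → ℝ, Continuous ψ → HasCompactSupport ψ → Integrable fun s => f' s * ψ s) :
    ∫ s, f s * shiftDeriv (-a) φ s = -∫ s, (f' s + a * f s) * φ s := by
  have hd : Continuous (deriv φ) := (contDiff_infty_iff_deriv.1 hφ).2.continuous
  have h := H φ hφ hc
  rw [iteratedDeriv_one, pow_one, neg_one_mul] at h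
  have e₁ : ∀ s, f s * shiftDeriv (-a) φ s = f s * deriv φ s - a * (f s * φ s) := fun s => by
    simp only [shiftDeriv, Pi.add_apply, Pi.smul_apply, smul_eq_mul]
    ring
  have e₂ : ∀ s, (f' s + a * f s) * φ s = f' s * φ s + a * (f s * φ s) := fun s => by ring
  simp_rw [e₁, e₂]
  rw [integral_sub (i₀ _ hd hc.deriv) ((i₀ _ hφ.continuous hc).const_mul a),
    integral_add (i₁ _ hφ.continuous hc) ((i₀ _ hφ.continuous hc).const_mul a), h]
  ring

/-! ### The formal adjoint of `dOp` -/

/-- The adjoint of D + a is -(D - a): coefficients change sign, the order reverses, and each factor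
contributes a sign. -/
theorem integral_dOp_mul {l : List ℝ} {g φ : ℝ → ℝ} (hg : g ∈ lineTest l.length)
    (hφ : ContDiff ℝ ∞ φ) (hc : HasCompactSupport φ) :
    ∫ s, dOp l g s * φ s
      = (-1) ^ l.length * ∫ s, g s * dOp (l.map Neg.neg).reverse φ s := by
  induction l generalizing g with
  | nil => simp [dOp]
  | cons a l ih =>
    obtain ⟨hs, hsc⟩ := dOp_smooth (l.map Neg.neg).reverse hφ hc
    have int : ∀ u ∈ lineTest 0, ∀ ψ : ℝ → ℝ, Continuous ψ → HasCompactSupport ψ →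
        Integrable fun s => u s * ψ s := fun u hu ψ hψ hψc =>
      (hu.1.continuous.mul hψ).integrable_of_hasCompactSupport hψc.mul_left
    have hw : HasWeakDeriv 1 g (deriv g) := by
      simpa using lineTest_hasWeakDeriv (j := 1) (by simp) ⟨g, hg⟩
    have h := integral_shiftDeriv_neg a hw hs hsc (int g (lineTest_mono (Nat.zero_le _) hg))
      (int _ (lineTest_mono (Nat.zero_le _) (deriv_mem_lineTest hg)))
    rw [dOp, ih (shiftDeriv_mem_lineTest a hg), List.map_cons, List.reverse_cons, dOp_append]
    simp only [dOp, List.length_cons]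
    rw [h, pow_succ]
    simp only [shiftDeriv, Pi.add_apply, Pi.smul_apply, smul_eq_mul]
    ring

/-- This gives a meaning in L^p to `dOp l f` for a Sobolev function f, by duality with test
functions. The induction replaces f by f' + af, which has one weak derivative fewer. -/
theorem exists_weak_dOp (l : List ℝ) (f : LpLine p)
    (hf : ∀ j ≤ l.length, ∃ h : LpLine p, HasWeakDeriv j f h) :
    ∃ h : LpLine p, ∀ φ : ℝ → ℝ, ContDiff ℝ ∞ φ → HasCompactSupport φ →
      ∫ s, h s * φ s = (-1) ^ l.length * ∫ s, f s * dOp (l.map Neg.neg).reverse φ s := by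
  induction l generalizing f with
  | nil => exact ⟨f, fun φ _ _ => by simp [dOp]⟩
  | cons a l ih =>
    obtain ⟨f', hf'⟩ := hf 1 (by simp)
    obtain ⟨h, hh⟩ := ih (f' + a • f) fun j hj => by
      obtain ⟨u, hu⟩ := hf (j + 1) (by simpa using hj)
      obtain ⟨v, hv⟩ := hf j (by simp; omega)
      exact ⟨u + a • v, (hf'.deriv_of_succ hu).add (hv.smul a)⟩
    refine ⟨h, fun φ hφ hc => ?_⟩
    obtain ⟨hs, hsc⟩ := dOp_smooth (l.map Neg.neg).reverse hφ hc
    have h₁ := integral_shiftDeriv_neg a hf' hs hsc (fun ψ => f.integrable_mul)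
      (fun ψ => f'.integrable_mul)
    have e : ∫ s, (f' + a • f : LpLine p) s * dOp (l.map Neg.neg).reverse φ s
        = ∫ s, (f' s + a * f s) * dOp (l.map Neg.neg).reverse φ s := by
      refine integral_congr_ae ?_
      filter_upwards [Lp.coeFn_add f' (a • f), Lp.coeFn_smul a f] with s h1 h2
      rw [h1, Pi.add_apply, h2, Pi.smul_apply, smul_eq_mul]
    rw [hh φ hφ hc, e, List.map_cons, List.reverse_cons, dOp_append]
    simp only [dOp, List.length_cons]
    rw [h₁, pow_succ]
    ring

/-- A function in `L^p` that is orthogonal to the range of `dOp l` on test functions vanishes. -/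
theorem eq_of_integral_mul_dOp_eq {l : List ℝ} (hl : ∀ a ∈ l, a ≠ 0) {f g : LpLine p}
    (h : ∀ φ : ℝ → ℝ, ContDiff ℝ ∞ φ → HasCompactSupport φ →
      ∫ s, f s * dOp l φ s = ∫ s, g s * dOp l φ s) : f = g := by
  have hpq := Real.HolderConjugate.conjExponent (Fact.out : 1 < p)
  set q := Real.conjExponent p
  -- Uniqueness of the weak derivative of order zero serves as the fundamental lemma of the calculus
  -- of variations. Test functions are then approximated in L^q by the range of `dOp l`.
  have h0 : HasWeakDeriv 0 (f : ℝ → ℝ) f := fun φ _ _ => by simp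
  refine HasWeakDeriv.unique h0 (fun φ hφ hc => ?_)
  rw [iteratedDeriv_zero, pow_zero, one_mul, ← sub_eq_zero,
    ← LpLine.integral_sub_mul _ _ hφ.continuous hc]
  refine abs_eq_zero.1 (le_antisymm (le_of_forall_pos_le_add fun ε hε => ?_) (abs_nonneg _))
  have hN : 0 < ‖f - g‖ + 1 := by positivity
  obtain ⟨ψ, hψ, hψc, hle⟩ := exists_lpn_sub_dOp_le hpq.symm.lt hl hφ hc (div_pos hε hN)
  obtain ⟨hs, hsc⟩ := dOp_smooth l hψ hψc
  have e : ∫ s, (f - g : LpLine p) s * φ s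
      = ∫ s, (f - g : LpLine p) s * (φ - dOp l ψ) s := by
    have z : ∫ s, (f - g : LpLine p) s * dOp l ψ s = 0 := by
      rw [LpLine.integral_sub_mul _ _ hs.continuous hsc, h ψ hψ hψc, sub_self]
    simp_rw [Pi.sub_apply, mul_sub]
    rw [integral_sub ((f - g).integrable_mul hφ.continuous hc)
      ((f - g).integrable_mul hs.continuous hsc), z, sub_zero]
  rw [e, zero_add]
  refine (LpLine.abs_integral_mul_le hpq _ (hφ.sub hs).continuous (hc.sub hsc)).trans ?_
  refine (mul_le_mul_of_nonneg_left hle (norm_nonneg _)).trans ?_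
  rw [mul_div_assoc', div_le_iff₀ hN]
  nlinarith

/-! ### Test functions in the Sobolev space -/

/-- The class in `L^p` of a continuous function with compact support. -/
noncomputable def testLp (p : ℝ) {f : ℝ → ℝ} (hf : f ∈ lineTest 0) : LpLine p :=
  (lineTest_memLp' hf p).toLp f

theorem norm_testLp {p : ℝ} {f : ℝ → ℝ} (hf : f ∈ lineTest 0) : ‖testLp p hf‖ = lpn p f :=
  Lp.norm_toLp _ _

theorem dist_testLp {f g : ℝ → ℝ} (hf : f ∈ lineTest 0) (hg : g ∈ lineTest 0) :
    dist (testLp p hf) (testLp p hg) = lpn p (f - g) := by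
  rw [dist_eq_norm, testLp, testLp, ← MemLp.toLp_sub]
  exact norm_testLp ((lineTest 0).sub_mem hf hg)

theorem iteratedDeriv_mem_lineTest_zero {j k : ℕ} (hj : j ≤ k) {g : ℝ → ℝ} (hg : g ∈ lineTest k) :
    iteratedDeriv j g ∈ lineTest 0 :=
  iteratedDeriv_mem_lineTest (by simpa using lineTest_mono hj hg)

theorem iteratedDeriv_sub_lineTest {j k : ℕ} (hj : j ≤ k) {f g : ℝ → ℝ} (hf : f ∈ lineTest k)
    (hg : g ∈ lineTest k) : iteratedDeriv j (f - g) = iteratedDeriv j f - iteratedDeriv j g := by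
  ext s
  exact iteratedDeriv_sub (lineTest_mono hj hf).1.contDiffAt (lineTest_mono hj hg).1.contDiffAt

theorem dOp_mem_lineTest_zero {k : ℕ} {l : List ℝ} (hl : l.length = k) {g : ℝ → ℝ}
    (hg : g ∈ lineTest k) : dOp l g ∈ lineTest 0 :=
  dOp_mem_lineTest l (by simpa [hl] using hg)

theorem dOp_sub {l : List ℝ} {f g : ℝ → ℝ} (hf : f ∈ lineTest l.length)
    (hg : g ∈ lineTest l.length) : dOp l (f - g) = dOp l f - dOp l g := by
  rw [sub_eq_add_neg, ← neg_one_smul ℝ g, dOp_add hf ((lineTest _).smul_mem _ hg), dOp_smul _ hg,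
    neg_one_smul, sub_eq_add_neg]

namespace SobolevSpace

variable {k : ℕ}

theorem toLp_injective : Function.Injective (toLp (k := k) (p := p)) := Subtype.val_injective

theorem norm_le_add (g : SobolevSpace k p) : ‖g‖ ≤ ‖weakDeriv g‖ + ‖toLp g‖ := by
  have hp : 1 < p := Fact.out
  have h := WithLp.prod_norm_eq_add (p := ENNReal.ofReal p) 
    (by rw [ENNReal.toReal_ofReal] <;> linarith)
    (toPair g)
  rw [ENNReal.toReal_ofReal (zero_lt_one.trans hp).le] at h
  refine (le_of_eq h).trans ?_
  exact Real.rpow_add_rpow_le_add (norm_nonneg (weakDeriv g)) (norm_nonneg (toLp g)) hp.le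

theorem norm_components_le (g : SobolevSpace k p) : ‖weakDeriv g‖ ≤ ‖g‖ ∧ ‖toLp g‖ ≤ ‖g‖ :=
  ⟨WithLp.norm_fst_le _ (toPair g), WithLp.norm_snd_le _ (toPair g)⟩

theorem tendsto_of_components {g : ℕ → SobolevSpace k p} {g₀ : SobolevSpace k p}
    (h₁ : Tendsto (fun i => weakDeriv (g i)) atTop (𝓝 (weakDeriv g₀)))
    (h₂ : Tendsto (fun i => toLp (g i)) atTop (𝓝 (toLp g₀))) : Tendsto g atTop (𝓝 g₀) := by
  rw [tendsto_iff_norm_sub_tendsto_zero] at h₁ h₂ ⊢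
  refine squeeze_zero (fun _ => norm_nonneg _) (fun i => ?_) (by simpa using h₁.add h₂)
  rw [← map_sub, ← map_sub]
  exact norm_le_add _

end SobolevSpace

end

/-- The inclusion of `C_c^k(ℝ)` into `W^{k,p}(ℝ)` as a linear map. -/
noncomputable def lineTestToSobolevₗ (k : ℕ) (p : ℝ) [Fact (1 < p)] :
    lineTest k →ₗ[ℝ] SobolevSpace k p where
  toFun := lineTestToSobolev k p
  map_add' f g := SobolevSpace.toLp_injective
    (MemLp.toLp_add (lineTest_memLp (Nat.zero_le k) f p) (lineTest_memLp (Nat.zero_le k) g p))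
  map_smul' c g := SobolevSpace.toLp_injective
    (MemLp.toLp_const_smul c (lineTest_memLp (Nat.zero_le k) g p))

section

variable {p : ℝ} [Fact (1 < p)] {k : ℕ}

theorem toLp_lineTestToSobolev (g : lineTest k) :
    SobolevSpace.toLp (lineTestToSobolev k p g) = testLp p (lineTest_mono (Nat.zero_le k) g.2) :=
  rfl

theorem testLp_hasWeakDeriv {p : ℝ} {j : ℕ} (hj : j ≤ k) (g : lineTest k) :
    HasWeakDeriv j (testLp p (lineTest_mono (Nat.zero_le k) g.2))
      (testLp p (iteratedDeriv_mem_lineTest_zero hj g.2)) :=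
  (lineTest_hasWeakDeriv hj g).congr (MemLp.coeFn_toLp _) (MemLp.coeFn_toLp _)

theorem weakDeriv_lineTestToSobolev (g : lineTest k) :
    SobolevSpace.weakDeriv (lineTestToSobolev k p g)
      = testLp p (iteratedDeriv_mem_lineTest_zero le_rfl g.2) :=
  HasWeakDeriv.unique (SobolevSpace.hasWeakDeriv _) (testLp_hasWeakDeriv le_rfl g)

theorem exists_norm_lineTestToSobolev_le {l : List ℝ} (hk : l.length = k) (hl : ∀ a ∈ l, a ≠ 0) :
    ∃ C, ∀ g : lineTest k, ‖lineTestToSobolev k p g‖ ≤ C * lpn p (dOp l g.1) := by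
  subst hk
  obtain ⟨C, _, h⟩ := exists_lpn_iteratedDeriv_le (Fact.out : 1 < p) l hl
  refine ⟨C + C, fun g => (SobolevSpace.norm_le_add _).trans ?_⟩
  rw [weakDeriv_lineTestToSobolev, toLp_lineTestToSobolev, norm_testLp, norm_testLp, add_mul]
  have h0 := h g.1 g.2 0 (Nat.zero_le _)
  rw [iteratedDeriv_zero] at h0
  exact add_le_add (h g.1 g.2 _ le_rfl) h0

/-- The Sobolev norm sees only g and its top derivative; interpolation recovers the intermediate
ones. The coefficients may vanish in this direction. -/
theorem exists_lpn_dOp_le_norm {l : List ℝ} (hk : l.length = k) :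
    ∃ C, ∀ g : lineTest k, lpn p (dOp l g.1) ≤ C * ‖lineTestToSobolev k p g‖ := by
  subst hk
  obtain ⟨C, hC, h⟩ := exists_lpn_dOp_le (Fact.out : 1 < p) l
  obtain ⟨B, hB, h'⟩ := exists_lpn_iteratedDeriv_le_add (Fact.out : 1 < p) l.length
  refine ⟨C * (B * 2), fun g => ?_⟩
  refine (h g.1 g.2 _ (h' g.1 g.2)).trans ?_
  obtain ⟨h1, h2⟩ := SobolevSpace.norm_components_le (lineTestToSobolev l.length p g)
  rw [weakDeriv_lineTestToSobolev, norm_testLp] at h1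
  rw [toLp_lineTestToSobolev, norm_testLp] at h2
  rw [mul_assoc, mul_assoc]
  gcongr
  linarith

/-! ### Density of test functions and completeness of the Sobolev space -/

theorem CauchySeq.of_dist_le_mul {X Y : Type*} [PseudoMetricSpace X] [PseudoMetricSpace Y]
    {u : ℕ → X} {v : ℕ → Y} (hv : CauchySeq v) (C : ℝ)
    (h : ∀ i j, dist (u i) (u j) ≤ C * dist (v i) (v j)) : CauchySeq u := by
  rw [cauchySeq_iff_tendsto_dist_atTop_0] at hv ⊢
  exact squeeze_zero (fun _ => dist_nonneg) (fun n => h n.1 n.2) (by simpa using hv.const_mul C)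

/-- If `dOp l (φ i)` is a Cauchy sequence in `L^p`, then `φ i` converges in `W^{k,p}`. -/
theorem exists_tendsto_of_cauchySeq_dOp {l : List ℝ} (hk : l.length = k) (hl : ∀ a ∈ l, a ≠ 0)
    (φ : ℕ → lineTest k)
    (h : CauchySeq fun i => testLp p (dOp_mem_lineTest_zero hk (φ i).2)) :
    ∃ g, Tendsto (fun i => lineTestToSobolev k p (φ i)) atTop (𝓝 g) := by
  obtain ⟨C, _, hC⟩ := exists_lpn_iteratedDeriv_le (Fact.out : 1 < p) l hl
  -- All orders j are needed, although the norm involves only 0 and k: the limit must have every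
  -- intermediate weak derivative in L^p.
  have hcau : ∀ j (hj : j ≤ k),
      CauchySeq fun i => testLp p (iteratedDeriv_mem_lineTest_zero hj (φ i).2) := fun j hj => by
    refine h.of_dist_le_mul C fun i m => ?_
    subst hk
    rw [dist_testLp, dist_testLp, ← iteratedDeriv_sub_lineTest hj (φ i).2 (φ m).2,
      ← dOp_sub (φ i).2 (φ m).2]
    exact hC _ ((lineTest _).sub_mem (φ i).2 (φ m).2) j hj
  have hlim : ∀ j (hj : j ≤ k), ∃ G : LpLine p,
      Tendsto (fun i => testLp p (iteratedDeriv_mem_lineTest_zero hj (φ i).2)) atTop (𝓝 G) :=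
    fun j hj => cauchySeq_tendsto_of_complete (hcau j hj)
  obtain ⟨f, hf⟩ := hlim 0 (Nat.zero_le k)
  simp only [iteratedDeriv_zero] at hf
  have hweak : ∀ j (hj : j ≤ k), ∃ G : LpLine p, HasWeakDeriv j f G ∧
      Tendsto (fun i => testLp p (iteratedDeriv_mem_lineTest_zero hj (φ i).2)) atTop (𝓝 G) :=
    fun j hj => by
      obtain ⟨G, hG⟩ := hlim j hj
      exact ⟨G, HasWeakDeriv.of_tendsto hf hG fun i => testLp_hasWeakDeriv hj (φ i), hG⟩
  let g : SobolevSpace k p := ⟨f, fun j hj => (hweak j hj).imp fun _ h => h.1⟩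
  refine ⟨g, SobolevSpace.tendsto_of_components ?_ hf⟩
  obtain ⟨G, hG, hGt⟩ := hweak k le_rfl
  have e : SobolevSpace.weakDeriv g = G := HasWeakDeriv.unique (SobolevSpace.hasWeakDeriv g) hG
  rw [e]
  simp_rw [weakDeriv_lineTestToSobolev]
  exact hGt

theorem exists_smooth_dOp_dist_lt {l : List ℝ} (hk : l.length = k) (hl : ∀ a ∈ l, a ≠ 0)
    (h : LpLine p) {ε : ℝ} (hε : 0 < ε) :
    ∃ φ : lineTest k, dist (testLp p (dOp_mem_lineTest_zero hk φ.2)) h < ε := by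
  obtain ⟨u, ⟨f, hf, hfc, hfs⟩, hu⟩ := Metric.dense_iff.1
    (Lp.dense_hasCompactSupport_contDiff (F := ℝ) (μ := (volume : Measure ℝ))
      (p := ENNReal.ofReal p) ENNReal.ofReal_ne_top) h (ε / 2) (half_pos hε) |>.imp fun _ h => h.symm
  obtain ⟨φ, hφ, hφc, hle⟩ := exists_lpn_sub_dOp_le (Fact.out : 1 < p) hl hfs hfc
    (show 0 < ε / 4 by positivity)
  refine ⟨⟨φ, mem_lineTest_of_smooth hφ hφc k⟩, ?_⟩
  have hf0 := mem_lineTest_of_smooth hfs hfc 0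
  have e : u = testLp p hf0 := Lp.ext (hf.trans (MemLp.coeFn_toLp _).symm)
  rw [← dist_testLp hf0 (dOp_mem_lineTest_zero hk (mem_lineTest_of_smooth hφ hφc k)), ← e,
    dist_comm] at hle
  rw [Metric.mem_ball] at hu
  linarith [dist_triangle (testLp p (dOp_mem_lineTest_zero hk (mem_lineTest_of_smooth hφ hφc k))) u h]

theorem exists_tendsto_lineTestToSobolev (g : SobolevSpace k p) :
    ∃ φ : ℕ → lineTest k, Tendsto (fun i => lineTestToSobolev k p (φ i)) atTop (𝓝 g) := by
  -- Any invertible operator of order k would do; (D + 1)^k is chosen.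
  obtain ⟨l, hk, hl⟩ : ∃ l : List ℝ, l.length = k ∧ ∀ a ∈ l, a ≠ 0 :=
    ⟨List.replicate k 1, by simp, fun a ha => by simp [List.eq_of_mem_replicate ha]⟩
  obtain ⟨h, hh⟩ := exists_weak_dOp l (SobolevSpace.toLp g) fun j hj => g.2 j (hk ▸ hj)
  choose φ hφ using fun i : ℕ => exists_smooth_dOp_dist_lt hk hl h (Nat.one_div_pos_of_nat (n := i))
  have hlim : Tendsto (fun i => testLp p (dOp_mem_lineTest_zero hk (φ i).2)) atTop (𝓝 h) :=
    tendsto_iff_dist_tendsto_zero.2 (squeeze_zero (fun _ => dist_nonneg) (fun i => (hφ i).le)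
      tendsto_one_div_add_atTop_nhds_zero_nat)
  obtain ⟨g₀, hg₀⟩ := exists_tendsto_of_cauchySeq_dOp hk hl φ hlim.cauchySeq
  -- Both functions have the same weak image h under `dOp l`, so they agree against the range of the
  -- adjoint, which is dense in L^q.
  have e : g = g₀ := by
    refine SobolevSpace.toLp_injective
      (eq_of_integral_mul_dOp_eq (l := (l.map Neg.neg).reverse) ?_ ?_)
    · intro a ha
      obtain ⟨b, hb, rfl⟩ := List.mem_map.1 (List.mem_reverse.1 ha)
      exact neg_ne_zero.2 (hl b hb)
    · intro ψ hψ hψc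
      obtain ⟨hs, hsc⟩ := dOp_smooth (l.map Neg.neg).reverse hψ hψc
      refine mul_left_cancel₀ (pow_ne_zero l.length (by norm_num : (-1 : ℝ) ≠ 0)) ?_
      rw [← hh ψ hψ hψc]
      have t₁ := LpLine.tendsto_integral_mul hlim hψ.continuous hψc
      have t₀ : Tendsto (fun i => SobolevSpace.toLp (lineTestToSobolev k p (φ i))) atTop
          (𝓝 (SobolevSpace.toLp g₀)) := by
        rw [tendsto_iff_norm_sub_tendsto_zero] at hg₀ ⊢
        refine squeeze_zero (fun _ => norm_nonneg _) (fun i => ?_) hg₀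
        rw [← map_sub]
        exact (SobolevSpace.norm_components_le _).2
      have t₂ := (LpLine.tendsto_integral_mul t₀ hs.continuous hsc).const_mul ((-1) ^ l.length)
      refine tendsto_nhds_unique t₁ (t₂.congr fun i => ?_)
      have c₁ : ∫ s, testLp p (dOp_mem_lineTest_zero hk (φ i).2) s * ψ s
          = ∫ s, dOp l (φ i).1 s * ψ s := integral_congr_ae (by
        filter_upwards [MemLp.coeFn_toLp (lineTest_memLp' (dOp_mem_lineTest_zero hk (φ i).2) p)]
          with s hs
        rw [testLp, hs])
      have c₂ : ∫ s, SobolevSpace.toLp (lineTestToSobolev k p (φ i)) s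
            * dOp (l.map Neg.neg).reverse ψ s
          = ∫ s, (φ i).1 s * dOp (l.map Neg.neg).reverse ψ s := integral_congr_ae (by
        filter_upwards [MemLp.coeFn_toLp (lineTest_memLp' (lineTest_mono (Nat.zero_le k) (φ i).2) p)]
          with s hs
        rw [toLp_lineTestToSobolev, testLp, hs])
      rw [c₁, c₂, integral_dOp_mul (by rw [hk]; exact (φ i).2) hψ hψc]
  exact ⟨φ, e ▸ hg₀⟩

theorem denseRange_lineTestToSobolev : DenseRange (lineTestToSobolev k p) := fun g => by
  obtain ⟨φ, hφ⟩ := exists_tendsto_lineTestToSobolev g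
  exact mem_closure_of_tendsto hφ (Eventually.of_forall fun i => mem_range_self _)

instance : CompleteSpace (SobolevSpace k p) := by
  refine Metric.complete_of_cauchySeq_tendsto fun u hu => ?_
  obtain ⟨l, hk, hl⟩ : ∃ l : List ℝ, l.length = k ∧ ∀ a ∈ l, a ≠ 0 :=
    ⟨List.replicate k 1, by simp, fun a ha => by simp [List.eq_of_mem_replicate ha]⟩
  choose φ hφ using fun i : ℕ => denseRange_lineTestToSobolev.exists_dist_lt (u i)
    (Nat.one_div_pos_of_nat (n := i) : (0 : ℝ) < 1 / ((i : ℝ) + 1))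
  have hd : Tendsto (fun i => dist (u i) (lineTestToSobolev k p (φ i))) atTop (𝓝 0) :=
    squeeze_zero (fun _ => dist_nonneg) (fun i => (hφ i).le)
      tendsto_one_div_add_atTop_nhds_zero_nat
  have hc : CauchySeq fun i => lineTestToSobolev k p (φ i) := by
    rw [cauchySeq_iff_tendsto_dist_atTop_0] at hu ⊢
    have h₁ := hd.comp (tendsto_fst (α := ℕ) (f := atTop) (g := (atTop : Filter ℕ)))
    have h₂ := hd.comp (tendsto_snd (α := ℕ) (f := atTop) (g := (atTop : Filter ℕ)))
    rw [prod_atTop_atTop_eq] at h₁ h₂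
    refine squeeze_zero (fun _ => dist_nonneg) (fun n => ?_) (by simpa using (h₁.add hu).add h₂)
    refine (dist_triangle4 _ (u n.1) (u n.2) _).trans (le_of_eq ?_)
    rw [dist_comm (lineTestToSobolev k p (φ n.1))]
  -- The Cauchy sequence has been replaced by test functions at distance below 1/(i + 1). Their
  -- images under `dOp l` are Cauchy in L^p, hence they converge in the Sobolev space.
  obtain ⟨C, hC⟩ := exists_lpn_dOp_le_norm (p := p) hk
  obtain ⟨g, hg⟩ := exists_tendsto_of_cauchySeq_dOp hk hl φ (hc.of_dist_le_mul C fun i m => by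
    rw [dist_testLp (p := p), ← dOp_sub (by rw [hk]; exact (φ i).2) (by rw [hk]; exact (φ m).2),
      dist_eq_norm]
    exact (hC (φ i - φ m)).trans (le_of_eq rfl))
  refine ⟨g, ?_⟩
  rw [tendsto_iff_dist_tendsto_zero] at hg ⊢
  exact squeeze_zero (fun _ => dist_nonneg) (fun i => dist_triangle _ _ _)
    (by simpa using hd.add hg)

end

/-! ### Derivatives of the radial functions `x ↦ |x|^{-H} g(-log |x|)` -/

/-- The function `x ↦ |x|^{-H} g(-log |x|)`, extended by `0` at the origin. -/
noncomputable def radialPow {n : ℕ} (H : ℝ) (g : ℝ → ℝ) (x : EuclideanSpace ℝ (Fin n)) : ℝ :=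
  if x = 0 then 0 else ‖x‖ ^ (-H) * g (-Real.log ‖x‖)

section

variable {n : ℕ}

local notation "E" => EuclideanSpace ℝ (Fin n)

theorem radialPow_zero (H : ℝ) (g : ℝ → ℝ) : radialPow H g (0 : E) = 0 := if_pos rfl

theorem radialPow_of_ne (H : ℝ) (g : ℝ → ℝ) {x : E} (hx : x ≠ 0) :
    radialPow H g x = ‖x‖ ^ (-H) * g (-Real.log ‖x‖) := if_neg hx

theorem radialPow_add_mul_norm_rpow (H t : ℝ) (g : ℝ → ℝ) (x : E) :
    radialPow (H + t) g x * ‖x‖ ^ t = radialPow H g x := by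
  rcases eq_or_ne x 0 with rfl | hx
  · simp [radialPow_zero]
  · rw [radialPow_of_ne _ _ hx, radialPow_of_ne _ _ hx, neg_add, Real.rpow_add (norm_pos_iff.2 hx),
      Real.rpow_neg (norm_nonneg x) t]
    have := (Real.rpow_pos_of_pos (norm_pos_iff.2 hx) t).ne'
    field_simp

theorem radialPow_eventually_zero (H : ℝ) {g : ℝ → ℝ} (hg : HasCompactSupport g) :
    (radialPow H g : E → ℝ) =ᶠ[𝓝 0] fun _ => 0 := by
  obtain ⟨R, hR⟩ := hg.isBounded.subset_closedBall 0
  filter_upwards [Metric.ball_mem_nhds (0 : E) (Real.exp_pos (-R))] with x hx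
  rcases eq_or_ne x 0 with rfl | hx0
  · exact radialPow_zero _ _
  · rw [radialPow_of_ne _ _ hx0]
    rw [mem_ball_zero_iff, ← Real.log_lt_iff_lt_exp (norm_pos_iff.2 hx0)] at hx
    have : g (-Real.log ‖x‖) = 0 := by
      by_contra h
      have := hR (subset_tsupport g h)
      rw [mem_closedBall_zero_iff, Real.norm_eq_abs, abs_le] at this
      linarith [this.2]
    rw [this, mul_zero]

theorem hasFDerivAt_norm_of_ne {x : E} (hx : x ≠ 0) :
    HasFDerivAt (fun y : E => ‖y‖) (‖x‖⁻¹ • innerSL ℝ x) x := by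
  have h := (hasStrictFDerivAt_norm_sq x).hasFDerivAt.sqrt
    (pow_ne_zero 2 (norm_ne_zero_iff.2 hx))
  simp only [Real.sqrt_sq (norm_nonneg _)] at h
  refine h.congr_fderiv ?_
  ext y
  simp
  ring

/-- The radial derivative is -|x|^{-(H+1)} (D + H)g; the exponent H + 2 appears because the
direction x is not normalised. -/
theorem hasFDerivAt_radialPow (H : ℝ) {g : ℝ → ℝ} (hg : g ∈ lineTest 1) (x : E) :
    HasFDerivAt (radialPow H g : E → ℝ) (-radialPow (H + 2) (shiftDeriv H g) x • innerSL ℝ x) x := by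
  rcases eq_or_ne x 0 with rfl | hx
  · rw [radialPow_zero, neg_zero, zero_smul]
    exact (hasFDerivAt_const (0 : ℝ) (0 : E)).congr_of_eventuallyEq
      (radialPow_eventually_zero H hg.2)
  · have hr : 0 < ‖x‖ := norm_pos_iff.2 hx
    have h₁ : HasDerivAt (fun r : ℝ => r ^ (-H)) (-H * ‖x‖ ^ (-H - 1)) ‖x‖ :=
      Real.hasDerivAt_rpow_const (Or.inl hr.ne')
    have h₂ : HasDerivAt (fun r : ℝ => g (-Real.log r))
        (deriv g (-Real.log ‖x‖) * -‖x‖⁻¹) ‖x‖ :=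
      (lineTest_differentiable hg _).hasDerivAt.comp ‖x‖ (Real.hasDerivAt_log hr.ne').neg
    have h₃ := (h₁.mul h₂).comp_hasFDerivAt x (hasFDerivAt_norm_of_ne hx)
    have h₄ : HasFDerivAt (radialPow H g : E → ℝ) _ x := h₃.congr_of_eventuallyEq (by
      filter_upwards [isOpen_ne.mem_nhds hx] with y hy
      exact radialPow_of_ne _ _ hy)
    refine h₄.congr_fderiv ?_
    rw [smul_smul]
    congr 1
    rw [radialPow_of_ne _ _ hx]
    have e₁ : ‖x‖ ^ (-H - 1) = ‖x‖ ^ (-H) * ‖x‖⁻¹ := by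
      rw [Real.rpow_sub hr, Real.rpow_one, div_eq_mul_inv]
    have e₂ : ‖x‖ ^ (-(H + 2)) = ‖x‖ ^ (-H) * ‖x‖⁻¹ * ‖x‖⁻¹ := by
      rw [show -(H + 2) = -H - 1 - 1 by ring, Real.rpow_sub hr, Real.rpow_sub hr, Real.rpow_one,
        div_eq_mul_inv, div_eq_mul_inv]
    rw [e₁, e₂]
    simp only [shiftDeriv, Pi.add_apply, Pi.smul_apply, smul_eq_mul]
    ring

theorem norm_gradient_radialPow (H : ℝ) {g : ℝ → ℝ} (hg : g ∈ lineTest 1) (x : E) :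
    ‖∇ (radialPow H g) x‖ = |radialPow (H + 1) (shiftDeriv H g) x| := by
  rw [gradient, LinearIsometryEquiv.norm_map, (hasFDerivAt_radialPow H hg x).fderiv, norm_smul,
    innerSL_apply_norm, norm_neg, Real.norm_eq_abs, ← radialPow_add_mul_norm_rpow (H + 1) 1,
    Real.rpow_one, abs_mul, abs_norm, add_assoc, one_add_one_eq_two]

theorem laplacian_radialPow (H : ℝ) {g : ℝ → ℝ} (hg : g ∈ lineTest 2) :
    Δ (radialPow H g : E → ℝ)
      = radialPow (H + 2) (shiftDeriv (H + 2 - n) (shiftDeriv H g)) := by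
  have hf : shiftDeriv H g ∈ lineTest 1 := shiftDeriv_mem_lineTest H hg
  have hfd : ∀ v : E, (fun y => fderiv ℝ (radialPow H g : E → ℝ) y v)
      = fun y => -(radialPow (H + 2) (shiftDeriv H g) y * inner ℝ v y) := fun v => funext fun y => by
    rw [(hasFDerivAt_radialPow H (lineTest_mono one_le_two hg) y).fderiv]
    simp [real_inner_comm]
  -- With exponent 1 and weight H + 2 - n one has H_{α,2} = H, so the smoothness of the second order
  -- transform applies.
  have hcd : ContDiff ℝ 2 (radialPow H g : E → ℝ) := by
    have h := (emdenFowlerFun_mem n 2 (H + 2 - n) 1 ⟨g, hg⟩).1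
    have e : (emdenFowlerFun n 2 (H + 2 - n) 1 g : E → ℝ) = radialPow H g := by
      have : hardyExp n (H + 2 - n) 1 2 = H := by
        rw [hardyExp]
        push_cast
        ring
      ext y
      rw [emdenFowlerFun, this, radialPow]
    rw [← e]
    exact_mod_cast h
  ext x
  have hdiff : DifferentiableAt ℝ (fderiv ℝ (radialPow H g : E → ℝ)) x :=
    (hcd.fderiv_right (m := 1) (by norm_num)).differentiable one_ne_zero x
  -- Summed over an orthonormal basis, the first term yields |x|² and the second a factor n.
  have key : ∀ v : E, fderiv ℝ (fderiv ℝ (radialPow H g : E → ℝ)) x v v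
      = radialPow (H + 2 + 2) (shiftDeriv (H + 2) (shiftDeriv H g)) x * inner ℝ x v ^ 2
        - radialPow (H + 2) (shiftDeriv H g) x * ‖v‖ ^ 2 := by
    intro v
    have h1 := ((ContinuousLinearMap.apply ℝ ℝ v).hasFDerivAt.comp x hdiff.hasFDerivAt).fderiv
    have h2 := ((hasFDerivAt_radialPow (H + 2) hf x).mul (innerSL ℝ v).hasFDerivAt).neg.fderiv
    have h3 : fderiv ℝ (fderiv ℝ (radialPow H g : E → ℝ)) x v v
        = fderiv ℝ (fun y => fderiv ℝ (radialPow H g : E → ℝ) y v) x v :=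
      (DFunLike.congr_fun h1 v).symm
    rw [h3, hfd]
    refine (DFunLike.congr_fun h2 v).trans ?_
    simp only [add_apply, smul_apply,
      neg_apply, innerSL_apply_apply,
      smul_eq_mul, real_inner_self_eq_norm_sq, real_inner_comm x v]
    ring
  rw [InnerProductSpace.laplacian_eq_iteratedFDeriv_stdOrthonormalBasis]
  simp only [iteratedFDeriv_two_apply, Matrix.cons_val_zero, Matrix.cons_val_one, key]
  rw [Finset.sum_sub_distrib, ← Finset.mul_sum, (stdOrthonormalBasis ℝ E).sum_sq_inner_left]
  simp only [OrthonormalBasis.norm_eq_one, one_pow, mul_one, Finset.sum_const, Finset.card_univ,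
    Fintype.card_fin, finrank_euclideanSpace, nsmul_eq_mul]
  have e := radialPow_add_mul_norm_rpow (H + 2) 2 (shiftDeriv (H + 2) (shiftDeriv H g)) x
  rw [Real.rpow_two] at e
  rw [e]
  rcases eq_or_ne x 0 with rfl | hx
  · simp [radialPow_zero]
  · simp only [radialPow_of_ne _ _ hx]
    simp only [shiftDeriv, Pi.add_apply, Pi.smul_apply, smul_eq_mul]
    ring

/-- The coefficients of the first order operators whose composition corresponds to `Δ^m`. -/
def laplaceList (n : ℕ) : ℝ → ℕ → List ℝ
  | _, 0 => []
  | H, m + 1 => H :: (H + 2 - n) :: laplaceList n (H + 2) m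

theorem length_laplaceList (n : ℕ) (H : ℝ) (m : ℕ) : (laplaceList n H m).length = 2 * m := by
  induction m generalizing H with
  | zero => rfl
  | succ m ih => simp [laplaceList, ih]; ring

theorem exists_of_mem_laplaceList {n : ℕ} {H a : ℝ} {m : ℕ} (ha : a ∈ laplaceList n H m) :
    ∃ i < m, a = H + 2 * i ∨ a = H + 2 * i + 2 - n := by
  induction m generalizing H with
  | zero => simp [laplaceList] at ha
  | succ m ih =>
    simp only [laplaceList, List.mem_cons] at ha
    rcases ha with rfl | rfl | ha
    · exact ⟨0, by omega, by simp⟩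
    · exact ⟨0, by omega, by simp⟩
    · obtain ⟨i, hi, h⟩ := ih ha
      refine ⟨i + 1, by omega, h.imp (fun h => ?_) fun h => ?_⟩ <;> rw [h] <;> push_cast <;> ring

theorem iterate_laplacian_radialPow (H : ℝ) (m : ℕ) {g : ℝ → ℝ} (hg : g ∈ lineTest (2 * m)) :
    (fun w : E → ℝ => Δ w)^[m] (radialPow H g)
      = radialPow (H + 2 * m) (dOp (laplaceList n H m) g) := by
  induction m generalizing H g with
  | zero => simp [laplaceList, dOp]
  | succ m ih =>
    rw [Function.iterate_succ_apply, laplacian_radialPow H (lineTest_mono (by omega) hg),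
      ih (H + 2) (shiftDeriv_mem_lineTest _ (shiftDeriv_mem_lineTest _ hg))]
    simp only [laplaceList, dOp]
    congr 1
    push_cast
    ring

/-! ### The weighted norm in Emden-Fowler variables -/

theorem integral_Ioi_eq_integral_exp_neg (F : ℝ → ℝ) :
    ∫ y in Ioi (0 : ℝ), F y = ∫ s, Real.exp (-s) * F (Real.exp (-s)) := by
  have him : (fun s : ℝ => Real.exp (-s)) '' univ = Ioi 0 := by
    ext y
    simp only [image_univ, mem_range, mem_Ioi]
    exact ⟨fun ⟨s, hs⟩ => hs ▸ Real.exp_pos _, fun hy => ⟨-Real.log y, by simp [Real.exp_log hy]⟩⟩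
  have h := integral_image_eq_integral_abs_deriv_smul (s := univ) (f := fun s : ℝ => Real.exp (-s))
    (f' := fun s => Real.exp (-s) * -1) MeasurableSet.univ
    (fun s _ => ((hasDerivAt_neg s).exp).hasDerivWithinAt)
    (fun s _ t _ hst => neg_injective (Real.exp_injective hst)) F
  rw [him, setIntegral_univ] at h
  rw [h]
  congr 1
  ext s
  simp

/-- In polar coordinates with radius e^{-s}, the weight, the volume element and |x|^{-(n+α)} cancel
exactly. The constant is the area of the unit sphere, n times the volume of the ball. -/
theorem weightedNorm_eq_mul_lpn (hn : 0 < n) (α : ℝ) {p : ℝ} (hp : 1 < p) {f : ℝ → ℝ}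
    (hf : f ∈ lineTest 0) {F : Type*} [NormedAddCommGroup F] {v : E → F}
    (hv : ∀ x, ‖v x‖ = |radialPow ((n + α) / p) f x|) :
    weightedNorm α p v
      = (n * (volume : Measure E).real (Metric.ball 0 1)) ^ (1 / p) * lpn p f := by
  have hp0 : 0 < p := by linarith
  have : Nonempty (Fin n) := ⟨⟨0, hn⟩⟩
  set w : ℝ → ℝ := fun y =>
    y ^ α * |if y = 0 then 0 else y ^ (-((n + α) / p)) * f (-Real.log y)| ^ p with hw
  have e : ∀ x : E, ‖x‖ ^ α * ‖v x‖ ^ p = w ‖x‖ := fun x => by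
    rw [hv, hw]
    simp only [radialPow, norm_eq_zero]
  have hint : ∫ y in Ioi (0 : ℝ), y ^ (n - 1) • w y = ∫ s, |f s| ^ p := by
    rw [integral_Ioi_eq_integral_exp_neg]
    congr 1
    ext s
    have hs := Real.exp_pos (-s)
    simp only [hw, hs.ne', if_false, Real.log_exp, neg_neg, smul_eq_mul]
    rw [abs_mul, Real.mul_rpow (abs_nonneg _) (abs_nonneg _),
      abs_of_pos (Real.rpow_pos_of_pos hs _), ← Real.rpow_mul hs.le, ← mul_assoc, ← mul_assoc,
      ← mul_assoc, ← pow_succ', Nat.sub_add_cancel hn, ← Real.rpow_natCast, ← Real.rpow_add hs,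
      ← Real.rpow_add hs]
    rw [show (n : ℝ) + α + -((n + α) / p) * p = 0 by field_simp; ring, Real.rpow_zero, one_mul]
  rw [weightedNorm, lpn_eq_integral hp hf, ← Real.mul_rpow (by positivity)
    (integral_nonneg fun s => by positivity), ← hint]
  simp_rw [e]
  rw [integral_fun_norm_addHaar, finrank_euclideanSpace, Fintype.card_fin, nsmul_eq_mul,
    smul_eq_mul, mul_assoc]

/-- The coefficients of the first order operators whose composition corresponds to `∇^k` under the
Emden-Fowler transform. -/
noncomputable def emdenFowlerList (n k : ℕ) (α p : ℝ) : List ℝ :=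
  laplaceList n (hardyExp n α p k) (k / 2) ++ if Even k then [] else [hardyExp n α p 1]

theorem length_emdenFowlerList (n k : ℕ) (α p : ℝ) : (emdenFowlerList n k α p).length = k := by
  rw [emdenFowlerList, List.length_append, length_laplaceList]
  split_ifs with hk
  · have := Nat.even_iff.1 hk
    simp
    omega
  · have := Nat.not_even_iff.1 hk
    simp
    omega

theorem ne_zero_of_mem_emdenFowlerList {k : ℕ} {α p : ℝ} (hp : 1 < p)
    (hc : 0 < rellichConst n k α p) : ∀ a ∈ emdenFowlerList n k α p, a ≠ 0 := by
  have hp0 : p ≠ 0 := by linarith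
  have hlap : ∀ d : ℕ, k = 2 * (k / 2) + d →
      (∀ h ∈ Finset.Icc 1 (k / 2), gammaConst n α p (2 * h + d) ≠ 0) →
      ∀ a ∈ laplaceList n (hardyExp n α p k) (k / 2), a ≠ 0 := by
    intro d hd hγ a ha
    obtain ⟨i, hi, h⟩ := exists_of_mem_laplaceList ha
    -- The Laplacian number i, counted from 0, acts at exponent H_{α,k-2i}; its two coefficients
    -- are, up to sign, the factors of γ_{α,k-2i}. Here d is the parity of k.
    have hγi := hγ (k / 2 - i) (Finset.mem_Icc.2 ⟨by omega, by omega⟩)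
    have hcast : ((2 * (k / 2 - i) + d : ℕ) : ℝ) = k - 2 * i := by
      have h' : 2 * (k / 2 - i) + d + 2 * i = k := by omega
      have h'' : ((2 * (k / 2 - i) + d + 2 * i : ℕ) : ℝ) = k := by exact_mod_cast h'
      push_cast at h'' ⊢
      linarith
    rw [gammaConst, hcast] at hγi
    rcases h with rfl | rfl <;> intro h0 <;> rw [hardyExp] at h0
    · exact left_ne_zero_of_mul hγi (by linarith)
    · exact right_ne_zero_of_mul hγi (by linarith)
  have hprod : ∀ d : ℕ, ∏ h ∈ Finset.Icc 1 (k / 2), |gammaConst n α p (2 * h + d)| ^ p ≠ 0 →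
      ∀ h ∈ Finset.Icc 1 (k / 2), gammaConst n α p (2 * h + d) ≠ 0 := fun d h i hi h0 =>
    Finset.prod_ne_zero_iff.1 h i hi (by rw [h0, abs_zero, Real.zero_rpow hp0])
  intro a ha
  rw [rellichConst] at hc
  rw [emdenFowlerList, List.mem_append] at ha
  split_ifs at ha hc with hk
  · have := Nat.even_iff.1 hk
    exact hlap 0 (by omega) (hprod 0 hc.ne') a (by simpa using ha)
  · have := Nat.not_even_iff.1 hk
    rcases ha with ha | ha
    · exact hlap 1 (by omega) (hprod 1 (right_ne_zero_of_mul hc.ne')) a ha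
    · rw [List.mem_singleton.1 ha]
      intro h0
      exact left_ne_zero_of_mul hc.ne' (by rw [h0, abs_zero, Real.zero_rpow hp0])

theorem radialNorm_emdenFowlerFun (hn : 0 < n) {k : ℕ} (α : ℝ) {p : ℝ} (hp : 1 < p) {g : ℝ → ℝ}
    (hg : g ∈ lineTest k) :
    radialNorm k α p (emdenFowlerFun n k α p g)
      = (n * (volume : Measure E).real (Metric.ball 0 1)) ^ (1 / p)
        * lpn p (dOp (emdenFowlerList n k α p) g) := by
  have hl := dOp_mem_lineTest_zero (length_emdenFowlerList n k α p) hg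
  have hlap := iterate_laplacian_radialPow (n := n) (hardyExp n α p k) (k / 2)
    (lineTest_mono (by omega) hg)
  have e : (emdenFowlerFun n k α p g : E → ℝ) = radialPow (hardyExp n α p k) g := rfl
  rw [radialNorm, e, hlap]
  split_ifs with hk
  · refine weightedNorm_eq_mul_lpn hn α hp hl fun x => ?_
    have h2 : 2 * (k / 2) = k := by have := Nat.even_iff.1 hk; omega
    have h2' : (2 : ℝ) * ((k / 2 : ℕ) : ℝ) = k := by exact_mod_cast h2
    rw [Real.norm_eq_abs, emdenFowlerList, if_pos hk, List.append_nil, h2', hardyExp,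
      sub_add_cancel]
  · refine weightedNorm_eq_mul_lpn hn α hp hl fun x => ?_
    have h2 : 2 * (k / 2) + 1 = k := by have := Nat.not_even_iff.1 hk; omega
    have h2' : (2 : ℝ) * ((k / 2 : ℕ) : ℝ) + 1 = k := by exact_mod_cast h2
    have hH : hardyExp n α p k + 2 * ((k / 2 : ℕ) : ℝ) = hardyExp n α p 1 := by
      rw [hardyExp, hardyExp]
      push_cast
      linarith
    rw [hH, norm_gradient_radialPow _ (dOp_mem_lineTest _ (by
        rw [length_laplaceList, add_comm, h2]; exact hg)), emdenFowlerList, if_neg hk, dOp_append,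
      hardyExp, Nat.cast_one, sub_add_cancel]
    rfl

/-! ### The transform is a linear isomorphism of the spaces of test functions -/

theorem exists_emdenFowlerFun_eq (hn : 0 < n) {k : ℕ} (α p : ℝ) {u : E → ℝ}
    (hu : u ∈ radialTest n k) : ∃ g ∈ lineTest k, emdenFowlerFun n k α p g = u := by
  obtain ⟨hs, hc, h0, hr⟩ := hu
  have : Nonempty (Fin n) := ⟨⟨0, hn⟩⟩
  obtain ⟨e, he⟩ := exists_norm_eq E zero_le_one
  have hne : ∀ s : ℝ, ‖Real.exp s • e‖ = Real.exp s := fun s => by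
    rw [norm_smul, he, mul_one, Real.norm_eq_abs, abs_of_pos (Real.exp_pos _)]
  set H := hardyExp n α p k
  -- The inverse transform restricts u to the ray through a unit vector e. Vanishing near 0 and near
  -- infinity bounds the support in s from above and below.
  refine ⟨fun s => Real.exp (-(H * s)) * u (Real.exp (-s) • e), ⟨?_, ?_⟩, ?_⟩
  · have h1 : ContDiff ℝ k fun s : ℝ => Real.exp (-s) • e := by fun_prop
    have h2 : ContDiff ℝ k fun s : ℝ => Real.exp (-(H * s)) := by fun_prop
    exact h2.mul (hs.comp h1)
  · obtain ⟨R, hR⟩ := hc.isBounded.subset_closedBall 0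
    obtain ⟨r, hr0, hball⟩ := Metric.eventually_nhds_iff_ball.1 (notMem_tsupport_iff_eventuallyEq.1 h0)
    refine HasCompactSupport.of_support_subset_isCompact
      (isCompact_Icc (a := -Real.log R) (b := -Real.log r)) fun s hs => ?_
    have hus : u (Real.exp (-s) • e) ≠ 0 := right_ne_zero_of_mul hs
    have h1 := hR (subset_tsupport u hus)
    rw [mem_closedBall_zero_iff, hne] at h1
    have h2 : r ≤ Real.exp (-s) := by
      by_contra h
      exact hus (hball _ (by rw [mem_ball_zero_iff, hne]; exact not_le.1 h))
    have h3 := (Real.le_log_iff_exp_le ((Real.exp_pos _).trans_le h1)).2 h1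
    have h4 := (Real.log_le_iff_le_exp hr0).2 h2
    exact ⟨by linarith, by linarith⟩
  · ext x
    rcases eq_or_ne x 0 with rfl | hx
    · rw [emdenFowlerFun, if_pos rfl, image_eq_zero_of_notMem_tsupport h0]
    · have hpos := norm_pos_iff.2 hx
      rw [emdenFowlerFun, if_neg hx, neg_neg, Real.exp_log hpos,
        hr (‖x‖ • e) x (by rw [norm_smul, he, mul_one, norm_norm]), ← mul_assoc,
        show -(H * -Real.log ‖x‖) = Real.log ‖x‖ * H by ring, ← Real.rpow_def_of_pos hpos,
        ← Real.rpow_add hpos, neg_add_cancel, Real.rpow_zero, one_mul]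

theorem emdenFowlerFun_injective (hn : 0 < n) (k : ℕ) (α p : ℝ) :
    Function.Injective fun g => (emdenFowlerFun n k α p g : E → ℝ) := by
  intro f g h
  have : Nonempty (Fin n) := ⟨⟨0, hn⟩⟩
  ext s
  obtain ⟨x, hx⟩ := exists_norm_eq E (Real.exp_pos (-s)).le
  have hx0 : x ≠ 0 := norm_pos_iff.1 (hx ▸ Real.exp_pos _)
  have h' := congrFun h x
  simp only [emdenFowlerFun, if_neg hx0, hx, Real.log_exp, neg_neg] at h'
  exact mul_left_cancel₀ (Real.rpow_pos_of_pos (Real.exp_pos _) _).ne' h'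

end

/-- The transform `T_k` as a linear map on test functions. -/
noncomputable def emdenFowlerₗ (n k : ℕ) (α p : ℝ) : lineTest k →ₗ[ℝ] RadialSpace n k α p where
  toFun := emdenFowler n k α p
  map_add' f g := Subtype.ext (funext fun x => by
    change emdenFowlerFun n k α p (f.1 + g.1) x
      = emdenFowlerFun n k α p f.1 x + emdenFowlerFun n k α p g.1 x
    simp only [emdenFowlerFun]
    split_ifs <;> simp [mul_add])
  map_smul' c g := Subtype.ext (funext fun x => by
    change emdenFowlerFun n k α p (c • g.1) x = c * emdenFowlerFun n k α p g.1 x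
    simp only [emdenFowlerFun]
    split_ifs
    · simp
    · simp only [Pi.smul_apply, smul_eq_mul]
      ring)

/-- The transform `T_k` as a linear equivalence of spaces of test functions. -/
noncomputable def emdenFowlerEquiv {n : ℕ} (hn : 0 < n) (k : ℕ) (α p : ℝ) :
    lineTest k ≃ₗ[ℝ] RadialSpace n k α p :=
  LinearEquiv.ofBijective (emdenFowlerₗ n k α p)
    ⟨fun _ _ h => Subtype.ext (emdenFowlerFun_injective hn k α p (congrArg Subtype.val h)),
      fun u => by
        obtain ⟨g, hg, h⟩ := exists_emdenFowlerFun_eq hn α p u.2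
        exact ⟨⟨g, hg⟩, Subtype.ext h⟩⟩

theorem lemma5p4 (n k : ℕ) (hn : 2 ≤ n) (hk : 1 ≤ k) (α p : ℝ) [Fact (1 < p)]
    (hc : 0 < rellichConst n k α p) :
    ∃ T : SobolevSpace k p ≃L[ℝ] DRadial n k α p,
      (∀ g : lineTest k, T (lineTestToSobolev k p g) =
        ((emdenFowler n k α p g : RadialSpace n k α p) : DRadial n k α p)) ∧
      ∀ S : SobolevSpace k p → DRadial n k α p, Continuous S →
        (∀ g : lineTest k, S (lineTestToSobolev k p g) =
          ((emdenFowler n k α p g : RadialSpace n k α p) : DRadial n k α p)) →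
        S = T := by
  have hp : 1 < p := Fact.out
  have hn0 : 0 < n := by omega
  have hlen := length_emdenFowlerList n k α p
  have hne := ne_zero_of_mem_emdenFowlerList hp hc
  obtain ⟨A, hA⟩ := exists_lpn_dOp_le_norm (p := p) hlen
  obtain ⟨B, hB⟩ := exists_norm_lineTestToSobolev_le (p := p) hlen hne
  set K := (n * (volume : Measure (EuclideanSpace ℝ (Fin n))).real (Metric.ball 0 1)) ^ (1 / p)
    with hK
  have hK0 : 0 < K := by
    have h1 : 0 < (volume : Measure (EuclideanSpace ℝ (Fin n))).real (Metric.ball 0 1) :=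
      ENNReal.toReal_pos (Metric.measure_ball_pos _ _ one_pos).ne' measure_ball_lt_top.ne
    have h2 : (0 : ℝ) < n := by exact_mod_cast hn0
    positivity
  have hnorm : ∀ g : lineTest k, ‖emdenFowler n k α p g‖
      = K * lpn p (dOp (emdenFowlerList n k α p) g.1) := fun g =>
    radialNorm_emdenFowlerFun hn0 α hp g.2
  let f := emdenFowlerEquiv hn0 k α p
  let e₂ : RadialSpace n k α p →ₗ[ℝ] DRadial n k α p :=
    (UniformSpace.Completion.toComplₗᵢ (𝕜 := ℝ)).toLinearMap
  have hd₁ : DenseRange (lineTestToSobolevₗ k p) := denseRange_lineTestToSobolev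
  have hd₂ : DenseRange e₂ := UniformSpace.Completion.denseRange_coe
  have hn₁ : ∃ C, ∀ g, ‖e₂ (f g)‖ ≤ C * ‖lineTestToSobolevₗ k p g‖ := by
    refine ⟨K * A, fun g => ?_⟩
    have h1 : ‖e₂ (f g)‖ = ‖emdenFowler n k α p g‖ := UniformSpace.Completion.norm_coe _
    rw [h1, hnorm, mul_assoc]
    exact mul_le_mul_of_nonneg_left (hA g) hK0.le
  have hn₂ : ∃ C, ∀ u, ‖lineTestToSobolevₗ k p (f.symm u)‖ ≤ C * ‖e₂ u‖ := by
    refine ⟨B * K⁻¹, fun u => ?_⟩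
    obtain ⟨g, rfl⟩ := f.surjective u
    have h1 : ‖e₂ (f g)‖ = ‖emdenFowler n k α p g‖ := UniformSpace.Completion.norm_coe _
    rw [h1, hnorm, f.symm_apply_apply, mul_assoc, inv_mul_cancel_left₀ hK0.ne']
    exact hB g
  have hT : ∀ g : lineTest k, f.extend (lineTestToSobolevₗ k p) e₂ hd₁ hn₁ hd₂ hn₂
      (lineTestToSobolev k p g) = ((emdenFowler n k α p g : RadialSpace n k α p) : DRadial n k α p) :=
    fun g => LinearEquiv.extend_eq f _ _ hd₁ hn₁ hd₂ hn₂ g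
  refine ⟨f.extend (lineTestToSobolevₗ k p) e₂ hd₁ hn₁ hd₂ hn₂, hT, fun S hS h => ?_⟩
  -- Continuous maps into a Hausdorff space that agree on a dense set are equal; no linearity of S
  -- enters.
  exact denseRange_lineTestToSobolev.equalizer hS (ContinuousLinearEquiv.continuous _)
    (funext fun g => (h g).trans (hT g).symm)
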